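/- **Setting.** Let $\mathcal Y,\mathcal X$ be measurable spaces, $\Omega=\mathcal Y^{\mathbb Z}$ with the product $\sigma$-algebra $\mathcal F$, $\theta:\Omega\to\Omega$ the left shift, and $\mathbb P$ a $\theta$-invariant, mixing probability measure on $\Omega$ (the law of a stationary mixing sequence $(Y_j)_{j\in\mathbb Z}$; $Y_j(\omega)=\omega_j$). Let $\mathcal X_\omega\subseteq\mathcal X$ be measurable in $\omega$ (that is, $\{(\omega,x):x\in\mathcal X_\omega\}$ is measurable), and let $P_\omega(x,\cdot)$, $x\in\mathcal X_\omega$, be probability measures on $\mathcal X_{\theta\omega}$, measurable in $(\omega,x)$. Put $P_{\omega,n}=P_\omega\circ P_{\theta\omega}\circ\cdots\circ P_{\theta^{n-1}\omega}$. Assume the non-uniform Doeblin condition: there are random variables $n_\omega\in\mathbb N$, $\gamma_\omega\in(0,1)$ and probability measures $m_\omega$ on $\mathcal X_\omega$ such that, for $\mathbb P$-a.e. $\omega$, all $x\in\mathcal X_{\theta^{-n_\omega}\omega}$ and all measurable $\Gamma\subseteq\mathcal X_\omega$, $$P_{\theta^{-n_\omega}\omega,n_\omega}(x,\Gamma)\ge\gamma_\omega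 m_\omega(\Gamma).$$ For $-\infty\le s\le t\le\infty$ let $\mathcal F_{s,t}$ be the $\sigma$-algebra generated by the $Y_j$ with $j$ finite, $s\le j\le t$, and let $$\alpha(n)=\sup_k\{|\mathbb P(A\cap B)-\mathbb P(A)\mathbb P(B)|:A\in\mathcal F_{-\infty,k},\,B\in\mathcal F_{k+n,\infty}\},$$ $$\psi_U(n)=\sup_k\Big\{\tfrac{\mathbb P(A\cap B)}{\mathbb P(A)\mathbb P(B)}-1:A\in\mathcal F_{-\infty,k},\,B\in\mathcal F_{k+n,\infty},\,\mathbb P(A)\mathbb P(B)>0\Big\}.$$ **Assumption.** There are $\delta>0$, $M\in\mathbb N$ such that $A=\{\omega:\gamma_\omega\ge\delta,\ n_\omega\le M\}$ has $\mathbb P(A)>0$, and for every $r\in\mathbb N$ there are $A_r\in\mathcal F_{-r,r}$, $B_r\in\mathcal F$ and $b_r\in\mathbb R$ with $\mathbb P(B_r)\le b_r$, $A_r\subseteq A\cup B_r$ and $p_0=\lim_{r\to\infty}\mathbb P(A_r)>0$. Either $b_r=O(r^{-a})$ for some $a>3$, or $b_r=O(e^{-ar^\eta})$ for some $a,\eta>0$.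 Moreover, either $\alpha(r)=O(rb_r)$, or $(1+\limsup_{k\to\infty}\psi_U(k))\,(1-p_0(1-\delta))<1$. **Lemma.** Under this assumption there is a family $(\mu_\omega)_{\omega\in\Omega}$ of measures on $\mathcal X$ such that for $\mathbb P$-a.e. $\omega$ the measure $\mu_\omega$ is a probability measure on $\mathcal X_\omega$ and $\mu_{\theta\omega}=(P_\omega)^*\mu_\omega$, that is, $\mu_{\theta\omega}(\Gamma)=\int P_\omega(x,\Gamma)\,d\mu_\omega(x)$ for all measurable $\Gamma$; if $\omega\mapsto m_\omega$ is measurable, then $\omega\mapsto\mu_\omega$ is measurable too. The following holds for this family. (i) If $b_r=O(r^{-a})$ with $a>3$, then for all real $\beta$ and $d>0$ with $a>3+\beta d$ there is $K\in L^d(\mathbb P)$ such that for $\mathbb P$-a.e. $\omega$ and all $n\ge1$, $$\sup_{x\in\mathcal X_{\theta^{-n}\omega}}\ \sup_{\Gamma\subseteq\mathcal X_\omega\text{ measurable}}\big|P_{\theta^{-n}\omega,n}(x,\Gamma)-\mu_\omega(\Gamma)\big|\le K(\omega)\,n^{-\beta}.$$ (ii) If $b_r=O(e^{-ar^\eta})$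 with $a,\eta>0$, then for every $\kappa<\frac{\eta}{1+\eta}$ there is a random variable $K\in\bigcap_{1\le q<\infty}L^q(\mathbb P)$ such that for $\mathbb P$-a.e. $\omega$ and all $n\ge1$, $$\sup_{x\in\mathcal X_{\theta^{-n}\omega}}\ \sup_{\Gamma\subseteq\mathcal X_\omega\text{ measurable}}\big|P_{\theta^{-n}\omega,n}(x,\Gamma)-\mu_\omega(\Gamma)\big|\le K(\omega)\,e^{-n^\kappa}.$$ -/

import Mathlib

open MeasureTheory ProbabilityTheory Filter Topology Asymptotics
open scoped ENNReal NNReal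

namespace RandomEnv

variable {𝒴 : Type*} [MeasurableSpace 𝒴] {𝒳 : Type*} [MeasurableSpace 𝒳]

/-- The power `θ ^ n` (`n` any integer) of the left shift `θ` on `Ω = 𝒴 ^ ℤ`:
`(θ ^ n ω)_k = ω_(k + n)`. In particular `shift 1` is `θ` and `shift (-n)` is `θ ^ (-n)`. -/
def shift {𝒴 : Type*} (n : ℤ) (ω : ℤ → 𝒴) : ℤ → 𝒴 := fun k => ω (k + n)

/-- The measure-preserving shift system is mixing: `Pr (A ∩ θ ^ (-n) B) → Pr A * Pr B`
for all measurable `A`, `B`. -/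
def IsMixing (Pr : Measure (ℤ → 𝒴)) : Prop :=
  ∀ A B : Set (ℤ → 𝒴), MeasurableSet A → MeasurableSet B →
    Tendsto (fun n : ℕ => Pr (A ∩ shift (n : ℤ) ⁻¹' B)) atTop (𝓝 (Pr A * Pr B))

/-- The σ-algebra on `Ω = 𝒴 ^ ℤ` generated by the coordinates `ω_s`, `s ∈ S`. -/
abbrev coordSigma (𝒴 : Type*) [MeasurableSpace 𝒴] (S : Set ℤ) : MeasurableSpace (ℤ → 𝒴) :=
  ⨆ s ∈ S, MeasurableSpace.comap (fun ω : ℤ → 𝒴 => ω s) inferInstance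

/-- The `α`-mixing coefficients of the coordinate process under `Pr`. The set on the right is
nonempty and bounded above by `1` when `Pr` is a probability measure. -/
noncomputable def alphaMix (Pr : Measure (ℤ → 𝒴)) (n : ℕ) : ℝ :=
  sSup {v : ℝ | ∃ (k : ℤ) (A B : Set (ℤ → 𝒴)),
    MeasurableSet[coordSigma 𝒴 (Set.Iic k)] A ∧
    MeasurableSet[coordSigma 𝒴 (Set.Ici (k + n))] B ∧
    v = |Pr.real (A ∩ B) - Pr.real A * Pr.real B|}

/-- The `ψ_U`-mixing (upper `ψ`-mixing) coefficients of the coordinate process under `Pr`,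
with values in the extended reals since the supremum may be infinite. -/
noncomputable def psiU (Pr : Measure (ℤ → 𝒴)) (n : ℕ) : EReal :=
  sSup {v : EReal | ∃ (k : ℤ) (A B : Set (ℤ → 𝒴)),
    MeasurableSet[coordSigma 𝒴 (Set.Iic k)] A ∧
    MeasurableSet[coordSigma 𝒴 (Set.Ici (k + n))] B ∧
    0 < Pr.real A * Pr.real B ∧
    v = ((Pr.real (A ∩ B) / (Pr.real A * Pr.real B) - 1 : ℝ) : EReal)}

/-- `P (ω, x)` is the transition probability `P_ω(x, ·)`. The family is jointly measurable in
`(ω, x)`; only its values at `x ∈ X ω` matter, where `P_ω(x, ·)` is a probability measure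
on `X (θ ω)`. (A family given only on the measurable set `{(ω, x) | x ∈ X ω}` is extended by
the zero measure.) -/
structure IsTransitionFamily (X : (ℤ → 𝒴) → Set 𝒳) (P : Kernel ((ℤ → 𝒴) × 𝒳) 𝒳) : Prop where
  measurableSet_graph : MeasurableSet {p : (ℤ → 𝒴) × 𝒳 | p.2 ∈ X p.1}
  isProbabilityMeasure : ∀ ω, ∀ x ∈ X ω, IsProbabilityMeasure (P (ω, x))
  concentrated : ∀ ω, ∀ x ∈ X ω, P (ω, x) (X (shift 1 ω))ᶜ = 0

/-- The `n`-step transition probabilities `P_{ω,n} = P_ω ∘ P_{θω} ∘ ⋯ ∘ P_{θ^(n-1) ω}`: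
first a step according to `P_ω`, then `n - 1` steps in the environment `θ ω`, that is
`P_{ω,n+1}(x, Γ) = ∫ P_{θω,n}(y, Γ) P_ω(x, dy)`. -/
noncomputable def iter (P : Kernel ((ℤ → 𝒴) × 𝒳) 𝒳) : (ℤ → 𝒴) → ℕ → Kernel 𝒳 𝒳
  | _, 0 => Kernel.id
  | ω, n + 1 => iter P (shift 1 ω) n ∘ₖ P.sectR ω

/-- The non-uniform Doeblin minorization condition: almost surely `γ_ω ∈ (0,1)`, `m_ω` is a
probability measure on `X ω`, and `P_{θ^(-n_ω) ω, n_ω}(x, Γ) ≥ γ_ω m_ω(Γ)` for all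
`x ∈ X (θ^(-n_ω) ω)` and all measurable `Γ ⊆ X ω`. -/
def Doeblin (Pr : Measure (ℤ → 𝒴)) (X : (ℤ → 𝒴) → Set 𝒳) (P : Kernel ((ℤ → 𝒴) × 𝒳) 𝒳)
    (N : (ℤ → 𝒴) → ℕ) (γ : (ℤ → 𝒴) → ℝ) (m : (ℤ → 𝒴) → Measure 𝒳) : Prop :=
  ∀ᵐ ω ∂Pr, (0 < γ ω ∧ γ ω < 1) ∧ IsProbabilityMeasure (m ω) ∧ m ω (X ω)ᶜ = 0 ∧
    ∀ x ∈ X (shift (-(N ω : ℤ)) ω), ∀ Γ ⊆ X ω, MeasurableSet Γ →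
      ENNReal.ofReal (γ ω) * m ω Γ ≤ iter P (shift (-(N ω : ℤ)) ω) (N ω) x Γ

/-- The set `A_{δ,M} = {ω | γ_ω ≥ δ, n_ω ≤ M}`. -/
def goodSet (N : (ℤ → 𝒴) → ℕ) (γ : (ℤ → 𝒴) → ℝ) (δ : ℝ) (M : ℕ) : Set (ℤ → 𝒴) :=
  {ω | δ ≤ γ ω ∧ N ω ≤ M}

/-- `b_r = O(r^(-a))`. -/
def PolyDecay (b : ℕ → ℝ) (a : ℝ) : Prop :=
  b =O[atTop] fun r : ℕ => (r : ℝ) ^ (-a)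

/-- `b_r = O(exp(-a r^η))`. -/
def StretchedExpDecay (b : ℕ → ℝ) (a η : ℝ) : Prop :=
  b =O[atTop] fun r : ℕ => Real.exp (-a * (r : ℝ) ^ η)

/-- The quantitative assumption on the environment: `A = A_{δ,M}` has positive probability, it is
approximated by sets `A_r ∈ ℱ_{-r,r}` up to exceptional sets `B_r` of probability at most `b_r`,
where `b_r` decays polynomially or stretched exponentially, and either `α(r) = O(r b_r)` or
`(1 + limsup ψ_U(k)) (1 - p₀ (1 - δ)) < 1`, where `p₀ = lim Pr(A_r) > 0`. -/
structure EnvAssumption (Pr : Measure (ℤ → 𝒴)) (N : (ℤ → 𝒴) → ℕ) (γ : (ℤ → 𝒴) → ℝ)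
    (δ : ℝ) (M : ℕ) (A B : ℕ → Set (ℤ → 𝒴)) (b : ℕ → ℝ) (p₀ : ℝ) : Prop where
  delta_pos : 0 < δ
  good_pos : 0 < Pr (goodSet N γ δ M)
  local_A : ∀ r : ℕ, MeasurableSet[coordSigma 𝒴 (Set.Icc (-(r : ℤ)) r)] (A r)
  measurable_B : ∀ r, MeasurableSet (B r)
  prob_B : ∀ r, Pr.real (B r) ≤ b r
  subset : ∀ r, A r ⊆ goodSet N γ δ M ∪ B r
  tendsto_A : Tendsto (fun r => Pr.real (A r)) atTop (𝓝 p₀)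
  p₀_pos : 0 < p₀
  decay : (∃ a : ℝ, 3 < a ∧ PolyDecay b a) ∨
    (∃ a η : ℝ, 0 < a ∧ 0 < η ∧ StretchedExpDecay b a η)
  mixing_rate : (alphaMix Pr =O[atTop] fun r : ℕ => (r : ℝ) * b r) ∨
    (1 + limsup (psiU Pr) atTop) * ((1 - p₀ * (1 - δ) : ℝ) : EReal) < 1

end RandomEnv

open RandomEnv

/-! The argument is Dobrushin contraction along backward orbits. Call the largest total variation
distance between `Q x` and `Q y`, for `x`, `y` in `S`, the Dobrushin coefficient of `Q` on `S`. It
is submultiplicative under composition (`OscLE.comp`), and a Doeblin minorization with constant `γ`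
makes it at most `1 - γ`. Cut the last `n` steps before time `0` into `k` blocks of length `3 r ≥
M`. Every block whose right end lies in the good set contributes a factor `1 - δ`, so the `n`-step
coefficient is at most `(1 - δ) ^ hits` (`oscLE_iter_of_hits`).

It remains to show that few hits are unlikely. Replacing the good set by `A r`, which depends on the
coordinates in `[-r, r]` only, costs at most `k * b r` in expectation. The samples of `A r` are
separated by gaps of length `r`, so they decouple one at a time, with an additive error under
`α`-mixing and a multiplicative one under `ψ_U`-mixing. Hence `E[q ^ hits]` is at most a constant
times `ρ ^ k + k * (r * b r)` with `ρ < 1` (`EnvAssumption.integral_pow_hits_le`).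

The random constant `K` is the supremum over `n` of the weight `w n` times the contraction factor.
Its `d`-th power is at most the sum of the `d`-th powers, so `K ∈ L^d` follows from summability once
`k ~ n ^ s` and `r ~ n ^ (1 - s)` are chosen suitably.

Contraction along almost every backward orbit also makes the laws at time `0` of chains started at
`-n` Cauchy in total variation. Their limit is `μ ω`, and any bound on the `n`-step coefficient
bounds the distance to `μ ω` as well (`exists_equivariant_family`). -/

namespace RandomEnv

/-! ### Dobrushin coefficients: contraction and minorization. -/

section Oscillation

variable {α : Type*} [MeasurableSpace α]

/-- If the finite measures `ρ`, `ρ'` differ by at most `t` on the superlevel sets of a function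
with values in `[0, c]`, then its integrals differ by at most `c * t`. -/
theorem integral_le_add_of_superlevel {ρ ρ' : Measure α} [IsFiniteMeasure ρ] [IsFiniteMeasure ρ']
    {f : α → ℝ} (hf : Measurable f) {c t : ℝ} (h0 : ∀ x, 0 ≤ f x) (hc : ∀ x, f x ≤ c)
    (hc0 : 0 ≤ c) (h : ∀ s : ℝ, ρ.real {x | s ≤ f x} ≤ ρ'.real {x | s ≤ f x} + t) :
    ∫ x, f x ∂ρ ≤ ∫ x, f x ∂ρ' + c * t := by
  have hint : ∀ (ν : Measure α) [IsFiniteMeasure ν], Integrable f ν := fun ν _ =>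
    Integrable.of_bound hf.aestronglyMeasurable c (ae_of_all _ fun x => by
      rw [Real.norm_eq_abs, abs_of_nonneg (h0 x)]; exact hc x)
  have hanti : ∀ (ν : Measure α) [IsFiniteMeasure ν],
      IntegrableOn (fun s : ℝ => ν.real {x | s ≤ f x}) (Set.Ioc 0 c) := fun ν _ => by
    have : Antitone fun s : ℝ => ν.real {x | s ≤ f x} := fun s s' hs =>
      measureReal_mono (fun x (hx : s' ≤ f x) => hs.trans hx)
    exact (this.antitoneOn (Set.Icc 0 c)).integrableOn_isCompact isCompact_Icc
      |>.mono_set Set.Ioc_subset_Icc_self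
  -- Layer cake: both integrals become integrals over `s ∈ (0, c]` of the masses of the superlevel
  -- sets, which are compared level by level.
  rw [(hint ρ).integral_eq_integral_Ioc_meas_le (ae_of_all _ h0) (ae_of_all _ hc),
    (hint ρ').integral_eq_integral_Ioc_meas_le (ae_of_all _ h0) (ae_of_all _ hc)]
  have hconst : ∫ _ in Set.Ioc (0 : ℝ) c, t = c * t := by
    simp [hc0]
  rw [← hconst, ← integral_add (hanti ρ') (by simp)]
  exact setIntegral_mono (hanti ρ) ((hanti ρ').add (by simp)) h

/-- If two probability measures on `S` differ by at most `t` and `f` oscillates by at most `c`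
on `S`, then the integrals of `f` differ by at most `c * t`. -/
theorem integral_le_add_of_osc {ρ ρ' : Measure α} [IsProbabilityMeasure ρ]
    [IsProbabilityMeasure ρ'] {S : Set α} (hρ : ρ Sᶜ = 0) (hρ' : ρ' Sᶜ = 0)
    {f : α → ℝ} (hf : Measurable f) {c t : ℝ} (hc : ∀ x ∈ S, ∀ y ∈ S, f x ≤ f y + c)
    (h : ∀ Γ, MeasurableSet Γ → ρ.real Γ ≤ ρ'.real Γ + t) :
    ∫ x, f x ∂ρ ≤ ∫ x, f x ∂ρ' + c * t := by
  have hne : S.Nonempty := by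
    rw [Set.nonempty_iff_ne_empty]
    rintro rfl
    simp at hρ
  obtain ⟨y, hy⟩ := hne
  have hc0 : 0 ≤ c := by linarith [hc y hy y hy]
  have hbdd : BddBelow (f '' S) := ⟨f y - c, by
    rintro _ ⟨x, hx, rfl⟩
    linarith [hc y hy x hx]⟩
  set l := sInf (f '' S) with hl
  have hlo : ∀ x ∈ S, l ≤ f x := fun x hx => csInf_le hbdd ⟨x, hx, rfl⟩
  have hhi : ∀ x ∈ S, f x ≤ l + c := fun x hx => by
    have : f x - c ≤ l := le_csInf ⟨_, y, hy, rfl⟩ (by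
      rintro _ ⟨z, hz, rfl⟩
      linarith [hc x hx z hz])
    linarith
  -- Outside `S` nothing is known about `f`, so `f - inf_S f` is truncated to `[0, c]`; on `S` the
  -- truncation changes nothing.
  set g : α → ℝ := fun x => max 0 (min c (f x - l)) with hg
  have hgm : Measurable g := by fun_prop
  have hg0 : ∀ x, 0 ≤ g x := fun x => le_max_left _ _
  have hgc : ∀ x, g x ≤ c := fun x => max_le hc0 (min_le_left _ _)
  have hfg : ∀ (ν : Measure α) [IsProbabilityMeasure ν], ν Sᶜ = 0 →
      ∫ x, f x ∂ν = ∫ x, g x ∂ν + l := fun ν _ hν => by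
    have hint : Integrable g ν := Integrable.of_bound hgm.aestronglyMeasurable c
      (ae_of_all _ fun x => by rw [Real.norm_eq_abs, abs_of_nonneg (hg0 x)]; exact hgc x)
    have hae : f =ᵐ[ν] fun x => g x + l := by
      have : ∀ᵐ x ∂ν, x ∈ S := hν
      filter_upwards [this] with x hx
      have h1 := hlo x hx
      have h2 := hhi x hx
      simp only [hg]
      rw [min_eq_right (by linarith), max_eq_right (by linarith)]
      ring
    rw [integral_congr_ae hae, integral_add hint (integrable_const _)]
    simp
  rw [hfg ρ hρ, hfg ρ' hρ']
  have := integral_le_add_of_superlevel (ρ := ρ) (ρ' := ρ') hgm hg0 hgc hc0 (t := t)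
    (fun s => h _ (measurableSet_le measurable_const hgm))
  linarith

/-- The kernel `Q` maps points of `S` to probability measures on `T`. -/
def MapsProb (Q : Kernel α α) (S T : Set α) : Prop :=
  ∀ x ∈ S, IsProbabilityMeasure (Q x) ∧ Q x Tᶜ = 0

/-- The Dobrushin coefficient of the kernel `Q` on `S` is at most `c`. -/
def OscLE (Q : Kernel α α) (S : Set α) (c : ℝ) : Prop :=
  ∀ x ∈ S, ∀ y ∈ S, ∀ Γ, MeasurableSet Γ → (Q x).real Γ ≤ (Q y).real Γ + c

theorem OscLE.mono {Q : Kernel α α} {S : Set α} {c c' : ℝ} (h : OscLE Q S c) (hc : c ≤ c') :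
    OscLE Q S c' := fun x hx y hy Γ hΓ => (h x hx y hy Γ hΓ).trans (by gcongr)

theorem MapsProb.oscLE_one {Q : Kernel α α} {S T : Set α} (h : MapsProb Q S T) :
    OscLE Q S 1 := fun x hx y hy Γ _ => by
  have := (h x hx).1
  linarith [measureReal_le_one (μ := Q x) (s := Γ), measureReal_nonneg (μ := Q y) (s := Γ)]

theorem MapsProb.comp_measure {Q : Kernel α α} {S T : Set α} (h : MapsProb Q S T)
    (hT : MeasurableSet T) {ρ : Measure α} [IsProbabilityMeasure ρ] (hρ : ρ Sᶜ = 0) :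
    IsProbabilityMeasure (Q ∘ₘ ρ) ∧ (Q ∘ₘ ρ) Tᶜ = 0 := by
  have hS : ∀ᵐ x ∂ρ, x ∈ S := hρ
  refine ⟨⟨?_⟩, ?_⟩
  · rw [Measure.bind_apply MeasurableSet.univ Q.aemeasurable,
      lintegral_congr_ae (g := fun _ => 1) (hS.mono fun x hx => (h x hx).1.measure_univ)]
    simp
  · rw [Measure.bind_apply hT.compl Q.aemeasurable,
      lintegral_congr_ae (g := fun _ => 0) (hS.mono fun x hx => (h x hx).2)]
    simp

theorem MapsProb.comp {Q R : Kernel α α} {S T U : Set α} (hQ : MapsProb Q S T)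
    (hR : MapsProb R T U) (hU : MeasurableSet U) : MapsProb (R ∘ₖ Q) S U := fun x hx => by
  have := (hQ x hx).1
  rw [Kernel.comp_apply]
  exact hR.comp_measure hU (hQ x hx).2

theorem MapsProb.real_comp_measure {Q : Kernel α α} {S T : Set α} (h : MapsProb Q S T)
    {ρ : Measure α} (hρ : ρ Sᶜ = 0) {Γ : Set α} (hΓ : MeasurableSet Γ) :
    (Q ∘ₘ ρ).real Γ = ∫ x, (Q x).real Γ ∂ρ := by
  have hS : ∀ᵐ x ∂ρ, x ∈ S := hρ
  rw [Measure.real, Measure.bind_apply hΓ Q.aemeasurable]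
  refine (integral_toReal (Q.measurable_coe hΓ).aemeasurable (hS.mono fun x hx => ?_)).symm
  have := (h x hx).1
  exact measure_lt_top _ _

theorem measurable_real_kernel (Q : Kernel α α) {Γ : Set α} (hΓ : MeasurableSet Γ) :
    Measurable fun x => (Q x).real Γ :=
  (Q.measurable_coe hΓ).ennreal_toReal

/-- The function `x ↦ Q x Γ` oscillates by at most `c` on `S`, so integrating it against measures at
distance `t` gives the product `c * t` and not merely `t`. This is the source of
submultiplicativity. -/
theorem OscLE.comp_measure {Q : Kernel α α} {S T : Set α} {c t : ℝ} (hQ : OscLE Q S c)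
    (hS : MapsProb Q S T)
    {ρ ρ' : Measure α} [IsProbabilityMeasure ρ] [IsProbabilityMeasure ρ']
    (hρ : ρ Sᶜ = 0) (hρ' : ρ' Sᶜ = 0)
    (h : ∀ Γ, MeasurableSet Γ → ρ.real Γ ≤ ρ'.real Γ + t) {Γ : Set α} (hΓ : MeasurableSet Γ) :
    (Q ∘ₘ ρ).real Γ ≤ (Q ∘ₘ ρ').real Γ + c * t := by
  rw [hS.real_comp_measure hρ hΓ, hS.real_comp_measure hρ' hΓ]
  exact integral_le_add_of_osc hρ hρ' (measurable_real_kernel Q hΓ)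
    (fun x hx y hy => hQ x hx y hy Γ hΓ) h

theorem OscLE.comp {Q R : Kernel α α} {S T U : Set α} {c d : ℝ} (hQ : OscLE Q S c)
    (hR : OscLE R T d) (hST : MapsProb Q S T) (hTU : MapsProb R T U) :
    OscLE (R ∘ₖ Q) S (d * c) := fun x hx y hy Γ hΓ => by
  have := (hST x hx).1
  have := (hST y hy).1
  rw [Kernel.comp_apply, Kernel.comp_apply]
  exact hR.comp_measure hTU (hST x hx).2 (hST y hy).2 (hQ x hx y hy) hΓ

/-- The average of `Q` over a measure on `S` is within `c` of `Q x`. -/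
theorem OscLE.abs_sub_comp_measure_le {Q : Kernel α α} {S T : Set α} {c : ℝ} (hQ : OscLE Q S c)
    (hS : MapsProb Q S T) {ρ : Measure α} [IsProbabilityMeasure ρ] (hρ : ρ Sᶜ = 0)
    {x : α} (hx : x ∈ S) {Γ : Set α} (hΓ : MeasurableSet Γ) :
    |(Q x).real Γ - (Q ∘ₘ ρ).real Γ| ≤ c := by
  have hae : ∀ᵐ y ∂ρ, y ∈ S := hρ
  have hint : Integrable (fun y => (Q y).real Γ) ρ := by
    refine Integrable.of_bound (measurable_real_kernel Q hΓ).aestronglyMeasurable 1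
      (hae.mono fun y hy => ?_)
    have := (hS y hy).1
    rw [Real.norm_eq_abs, abs_of_nonneg measureReal_nonneg]
    exact measureReal_le_one
  rw [hS.real_comp_measure hρ hΓ, abs_le]
  constructor
  · have : ∫ y, (Q y).real Γ ∂ρ ≤ ∫ _, ((Q x).real Γ + c) ∂ρ :=
      integral_mono_ae hint (integrable_const _) (hae.mono fun y hy => hQ y hy x hx Γ hΓ)
    simp at this
    linarith
  · have : ∫ _, ((Q x).real Γ - c) ∂ρ ≤ ∫ y, (Q y).real Γ ∂ρ :=
      integral_mono_ae (integrable_const _) hint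
        (hae.mono fun y hy => by have := hQ x hx y hy Γ hΓ; simp only; linarith)
    simp at this
    linarith

/-- A Doeblin minorization bounds the Dobrushin coefficient. -/
theorem oscLE_of_minorization {Q : Kernel α α} {S T : Set α} (hQ : MapsProb Q S T)
    (hT : MeasurableSet T) {γ : ℝ} (hγ : 0 ≤ γ) {ν : Measure α} [IsProbabilityMeasure ν]
    (hν : ν Tᶜ = 0)
    (h : ∀ x ∈ S, ∀ Γ ⊆ T, MeasurableSet Γ → ENNReal.ofReal γ * ν Γ ≤ Q x Γ) :
    OscLE Q S (1 - γ) := by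
  have key : ∀ x ∈ S, ∀ Γ, MeasurableSet Γ → γ * ν.real Γ ≤ (Q x).real Γ := fun x hx Γ hΓ => by
    have := (hQ x hx).1
    have h1 := h x hx (Γ ∩ T) Set.inter_subset_right (hΓ.inter hT)
    have h2 := ENNReal.toReal_mono (measure_ne_top _ _) h1
    rw [ENNReal.toReal_mul, ENNReal.toReal_ofReal hγ] at h2
    have h3 : ν.real (Γ ∩ T) = ν.real Γ := by
      rw [Measure.real, Measure.real, measure_inter_conull hν]
    calc γ * ν.real Γ = γ * ν.real (Γ ∩ T) := by rw [h3]
      _ ≤ (Q x).real (Γ ∩ T) := h2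
      _ ≤ (Q x).real Γ := measureReal_mono Set.inter_subset_left
  intro x hx y hy Γ hΓ
  have := (hQ x hx).1
  -- Minorizing the complement bounds `Q x Γ` above by `1 - γ * (1 - ν Γ)`, while `Q y Γ ≥ γ * ν Γ`;
  -- the difference is `1 - γ`.
  have h1 := key x hx Γᶜ hΓ.compl
  have h2 := key y hy Γ hΓ
  rw [probReal_compl_eq_one_sub hΓ, probReal_compl_eq_one_sub hΓ] at h1
  nlinarith

end Oscillation

/-! ### The shift group and visit counts. -/

section Shift

variable {𝒴 : Type*}

theorem shift_shift (a b : ℤ) (ω : ℤ → 𝒴) : shift a (shift b ω) = shift (a + b) ω := by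
  funext k
  simp only [shift]
  congr 1
  ring

@[simp] theorem shift_zero (ω : ℤ → 𝒴) : shift 0 ω = ω := by
  funext k
  simp [shift]

open scoped Classical in
/-- The number of `j < k` with `θ ^ (-j L) ω ∈ G`. -/
noncomputable def hits (G : Set (ℤ → 𝒴)) (L k : ℕ) (ω : ℤ → 𝒴) : ℕ :=
  ∑ j ∈ Finset.range k, if shift (-((j * L : ℕ) : ℤ)) ω ∈ G then 1 else 0

open scoped Classical in
theorem hits_succ (G : Set (ℤ → 𝒴)) (L k : ℕ) (ω : ℤ → 𝒴) :
    hits G L (k + 1) ω =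
      hits G L k ω + if shift (-((k * L : ℕ) : ℤ)) ω ∈ G then 1 else 0 :=
  Finset.sum_range_succ _ _

variable [MeasurableSpace 𝒴]

theorem measurable_shift (n : ℤ) : Measurable (shift n : (ℤ → 𝒴) → (ℤ → 𝒴)) :=
  measurable_pi_lambda _ fun k => measurable_pi_apply (k + n)

theorem measurePreserving_shift {Pr : Measure (ℤ → 𝒴)}
    (hstat : MeasurePreserving (shift 1) Pr Pr) (n : ℤ) : MeasurePreserving (shift n) Pr Pr := by
  have hinv : MeasurePreserving (shift (-1)) Pr Pr := by
    refine ⟨measurable_shift _, ?_⟩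
    conv_lhs => rw [← hstat.map_eq]
    rw [Measure.map_map (measurable_shift _) (measurable_shift _)]
    have : (shift (-1) ∘ shift 1 : (ℤ → 𝒴) → (ℤ → 𝒴)) = id := by
      funext ω
      simp [shift_shift]
    rw [this, Measure.map_id]
  have step : ∀ (e : ℤ), MeasurePreserving (shift e) Pr Pr → ∀ k : ℕ,
      MeasurePreserving (shift (k * e)) Pr Pr := fun e he k => by
    induction k with
    | zero =>
      have : (shift (((0 : ℕ) : ℤ) * e) : (ℤ → 𝒴) → (ℤ → 𝒴)) = id := by
        funext ω
        simp
      rw [this]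
      exact MeasurePreserving.id _
    | succ k ih =>
      have : (shift (((k + 1 : ℕ) : ℤ) * e) : (ℤ → 𝒴) → (ℤ → 𝒴)) = shift e ∘ shift (k * e) := by
        funext ω
        simp only [Function.comp, shift_shift]
        congr 1
        push_cast
        ring
      rw [this]
      exact he.comp ih
  rcases Int.eq_nat_or_neg n with ⟨k, rfl | rfl⟩
  · simpa using step 1 hstat k
  · simpa using step (-1) hinv k

theorem measurable_hits {G : Set (ℤ → 𝒴)} (hG : MeasurableSet G) (L k : ℕ) :
    Measurable (hits G L k) := by
  classical
  refine Finset.measurable_sum _ fun j _ => ?_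
  exact Measurable.ite (measurable_shift _ hG) measurable_const measurable_const

end Shift

/-! ### Contraction along backward orbits. -/

section Chain

variable {𝒴 : Type*} [MeasurableSpace 𝒴] {𝒳 : Type*} [MeasurableSpace 𝒳]
  {X : (ℤ → 𝒴) → Set 𝒳} {P : Kernel ((ℤ → 𝒴) × 𝒳) 𝒳}
  {N : (ℤ → 𝒴) → ℕ} {γ : (ℤ → 𝒴) → ℝ} {m : (ℤ → 𝒴) → Measure 𝒳}

theorem iter_add (P : Kernel ((ℤ → 𝒴) × 𝒳) 𝒳) (ω : ℤ → 𝒴) (a b : ℕ) :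
    iter P ω (a + b) = iter P (shift a ω) b ∘ₖ iter P ω a := by
  induction a generalizing ω with
  | zero => simp [iter]
  | succ a ih =>
    rw [show a + 1 + b = (a + b) + 1 by ring, iter, iter, ih, shift_shift, Kernel.comp_assoc]
    push_cast
    rfl

/-- The kernel of the last `i` steps does not depend on `n`: lengthening a backward orbit only adds
earlier steps. Pullback convergence rests on this. -/
theorem iter_neg_split (P : Kernel ((ℤ → 𝒴) × 𝒳) 𝒳) (ω : ℤ → 𝒴) {i n : ℕ} (h : i ≤ n) :
    iter P (shift (-(n : ℤ)) ω) n =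
      iter P (shift (-(i : ℤ)) ω) i ∘ₖ iter P (shift (-(n : ℤ)) ω) (n - i) := by
  conv_lhs => rw [← Nat.sub_add_cancel h, iter_add, shift_shift]
  push_cast [Nat.cast_sub h]
  congr 3 <;> ring_nf

theorem IsTransitionFamily.measurableSet (hP : IsTransitionFamily X P) (ω : ℤ → 𝒴) :
    MeasurableSet (X ω) :=
  measurable_prodMk_left (x := ω) hP.measurableSet_graph

theorem IsTransitionFamily.mapsProb (hP : IsTransitionFamily X P) (ω : ℤ → 𝒴) :
    MapsProb (P.sectR ω) (X ω) (X (shift 1 ω)) := fun x hx => by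
  rw [Kernel.sectR_apply]
  exact ⟨hP.isProbabilityMeasure ω x hx, hP.concentrated ω x hx⟩

theorem IsTransitionFamily.mapsProb_iter (hP : IsTransitionFamily X P) (ω : ℤ → 𝒴) (n : ℕ) :
    MapsProb (iter P ω n) (X ω) (X (shift n ω)) := by
  induction n generalizing ω with
  | zero =>
    intro x hx
    rw [iter, Kernel.id_apply]
    refine ⟨inferInstance, ?_⟩
    rw [Measure.dirac_apply' _ (hP.measurableSet _).compl]
    simpa using hx
  | succ n ih =>
    have h := (hP.mapsProb ω).comp (ih (shift 1 ω)) (hP.measurableSet _)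
    rw [shift_shift] at h
    exact_mod_cast h

theorem IsTransitionFamily.mapsProb_iter_neg (hP : IsTransitionFamily X P) (ω : ℤ → 𝒴) (n i : ℕ) :
    MapsProb (iter P (shift (-(n : ℤ)) ω) i) (X (shift (-(n : ℤ)) ω))
      (X (shift (-(n : ℤ) + i) ω)) := by
  have h := hP.mapsProb_iter (shift (-(n : ℤ)) ω) i
  rwa [shift_shift, add_comm] at h

theorem IsTransitionFamily.mapsProb_iter_neg_self (hP : IsTransitionFamily X P) (ω : ℤ → 𝒴)
    (n : ℕ) :
    MapsProb (iter P (shift (-(n : ℤ)) ω) n) (X (shift (-(n : ℤ)) ω)) (X ω) := by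
  simpa using hP.mapsProb_iter_neg ω n n

theorem IsTransitionFamily.mapsProb_iter_neg_sub (hP : IsTransitionFamily X P) (ω : ℤ → 𝒴)
    {i n : ℕ} (h : i ≤ n) :
    MapsProb (iter P (shift (-(n : ℤ)) ω) (n - i)) (X (shift (-(n : ℤ)) ω))
      (X (shift (-(i : ℤ)) ω)) := by
  have := hP.mapsProb_iter_neg ω n (n - i)
  rwa [Nat.cast_sub h, show -(n : ℤ) + (n - i) = -i by ring] at this

theorem OscLE.iter_neg_of_le (hP : IsTransitionFamily X P) {ω : ℤ → 𝒴} {i n : ℕ} {c c' : ℝ}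
    (h : i ≤ n) (hc : OscLE (iter P (shift (-(i : ℤ)) ω) i) (X (shift (-(i : ℤ)) ω)) c)
    (hc' : OscLE (iter P (shift (-(n : ℤ)) ω) (n - i)) (X (shift (-(n : ℤ)) ω)) c') :
    OscLE (iter P (shift (-(n : ℤ)) ω) n) (X (shift (-(n : ℤ)) ω)) (c * c') := by
  rw [iter_neg_split P ω h]
  exact hc'.comp hc (hP.mapsProb_iter_neg_sub ω h) (hP.mapsProb_iter_neg_self ω i)

/-- Earlier steps have coefficient at most `1`, so a contraction reached over the last `i` steps
persists for all longer backward orbits. -/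
theorem OscLE.iter_neg_mono (hP : IsTransitionFamily X P) {ω : ℤ → 𝒴} {i n : ℕ} {c : ℝ}
    (h : i ≤ n) (hc : OscLE (iter P (shift (-(i : ℤ)) ω) i) (X (shift (-(i : ℤ)) ω)) c) :
    OscLE (iter P (shift (-(n : ℤ)) ω) n) (X (shift (-(n : ℤ)) ω)) c := by
  simpa using hc.iter_neg_of_le hP h (hP.mapsProb_iter_neg_sub ω h).oscLE_one

/-- The minorization condition at the single environment `ω`. -/
def DoeblinAt (X : (ℤ → 𝒴) → Set 𝒳) (P : Kernel ((ℤ → 𝒴) × 𝒳) 𝒳)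
    (N : (ℤ → 𝒴) → ℕ) (γ : (ℤ → 𝒴) → ℝ) (m : (ℤ → 𝒴) → Measure 𝒳) (ω : ℤ → 𝒴) : Prop :=
  (0 < γ ω ∧ γ ω < 1) ∧ IsProbabilityMeasure (m ω) ∧ m ω (X ω)ᶜ = 0 ∧
    ∀ x ∈ X (shift (-(N ω : ℤ)) ω), ∀ Γ ⊆ X ω, MeasurableSet Γ →
      ENNReal.ofReal (γ ω) * m ω Γ ≤ iter P (shift (-(N ω : ℤ)) ω) (N ω) x Γ

theorem DoeblinAt.oscLE (hP : IsTransitionFamily X P) {ω : ℤ → 𝒴} (h : DoeblinAt X P N γ m ω) :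
    OscLE (iter P (shift (-(N ω : ℤ)) ω) (N ω)) (X (shift (-(N ω : ℤ)) ω)) (1 - γ ω) := by
  obtain ⟨hγ, hm, hmX, hmin⟩ := h
  exact oscLE_of_minorization (hP.mapsProb_iter_neg_self ω _) (hP.measurableSet ω) hγ.1.le hmX hmin

/-- Each visit of the backward orbit, sampled at times `0, L, 2 L, …`, to the good set contracts
by the factor `1 - δ`. -/
theorem oscLE_iter_of_hits (hP : IsTransitionFamily X P) {ω : ℤ → 𝒴}
    (h : ∀ k : ℤ, DoeblinAt X P N γ m (shift k ω)) {δ : ℝ} {M L : ℕ}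
    (hL : M ≤ L) {k n : ℕ} (hn : k * L ≤ n) :
    OscLE (iter P (shift (-(n : ℤ)) ω) n) (X (shift (-(n : ℤ)) ω))
      ((1 - δ) ^ hits (goodSet N γ δ M) L k ω) := by
  classical
  suffices H : OscLE (iter P (shift (-((k * L : ℕ) : ℤ)) ω) (k * L))
      (X (shift (-((k * L : ℕ) : ℤ)) ω)) ((1 - δ) ^ hits (goodSet N γ δ M) L k ω) from
    H.iter_neg_mono hP hn
  clear hn n
  induction k with
  | zero =>
    simpa [hits] using (hP.mapsProb_iter_neg_self ω (0 * L)).oscLE_one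
  | succ k ih =>
    rw [hits_succ, pow_add]
    have hle : k * L ≤ (k + 1) * L := by gcongr; omega
    refine ih.iter_neg_of_le hP hle ?_
    have hsub : (k + 1) * L - k * L = L := by
      rw [Nat.add_mul, one_mul, Nat.add_sub_cancel_left]
    have hsh : shift (-(((k + 1) * L : ℕ) : ℤ)) ω =
        shift (-(L : ℤ)) (shift (-((k * L : ℕ) : ℤ)) ω) := by
      rw [shift_shift]
      congr 1
      push_cast
      ring
    rw [hsub, hsh]
    -- The added block ends in the environment `ω'`. If `ω'` is good, the minorization acts on the
    -- last `N ω' ≤ M ≤ L` steps of this block, hence does not overlap the other blocks.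
    set ω' := shift (-((k * L : ℕ) : ℤ)) ω with hω'
    split
    next hmem =>
      have hD := (h (-((k * L : ℕ) : ℤ))).oscLE hP
      rw [← hω'] at hD
      have h1 : δ ≤ γ ω' := hmem.1
      rw [pow_one]
      exact (hD.mono (by linarith)).iter_neg_mono hP (hmem.2.trans hL)
    next => simpa using (hP.mapsProb_iter_neg_self ω' L).oscLE_one

end Chain

/-! ### Completeness of probability measures in total variation. -/

section LimitMeasure

variable {α : Type*} [MeasurableSpace α]

/-- A sequence of probability measures that is Cauchy in total variation converges setwise,
uniformly over measurable sets, to a probability measure. -/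
theorem exists_uniform_limit_measure {ρ : ℕ → Measure α} [∀ n, IsProbabilityMeasure (ρ n)]
    (h : ∀ ε > 0, ∃ n, ∀ i ≥ n, ∀ Γ, MeasurableSet Γ → |(ρ i).real Γ - (ρ n).real Γ| ≤ ε) :
    ∃ μ : Measure α, IsProbabilityMeasure μ ∧
      ∀ ε > 0, ∃ n, ∀ i ≥ n, ∀ Γ, MeasurableSet Γ → |(ρ i).real Γ - μ.real Γ| ≤ ε := by
  have hcau : ∀ Γ, MeasurableSet Γ → ∃ l, Tendsto (fun n => (ρ n).real Γ) atTop (𝓝 l) := by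
    intro Γ hΓ
    refine cauchySeq_tendsto_of_complete (Metric.cauchySeq_iff'.2 fun ε hε => ?_)
    obtain ⟨n, hn⟩ := h (ε / 2) (by positivity)
    exact ⟨n, fun i hi => by rw [Real.dist_eq]; linarith [hn i hi Γ hΓ]⟩
  choose! F hF using hcau
  have hunif : ∀ ε > 0, ∃ n, ∀ i ≥ n, ∀ Γ, MeasurableSet Γ → |(ρ i).real Γ - F Γ| ≤ ε := by
    intro ε hε
    obtain ⟨n, hn⟩ := h (ε / 2) (by positivity)
    refine ⟨n, fun i hi Γ hΓ => ?_⟩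
    have h1 : |(ρ n).real Γ - F Γ| ≤ ε / 2 := by
      have ht : Tendsto (fun j => |(ρ j).real Γ - (ρ n).real Γ|) atTop
          (𝓝 |F Γ - (ρ n).real Γ|) := ((hF Γ hΓ).sub_const _).abs
      rw [abs_sub_comm]
      exact le_of_tendsto ht (eventually_atTop.2 ⟨n, fun j hj => hn j hj Γ hΓ⟩)
    calc |(ρ i).real Γ - F Γ| ≤ |(ρ i).real Γ - (ρ n).real Γ| + |(ρ n).real Γ - F Γ| :=
          abs_sub_le _ _ _
      _ ≤ ε / 2 + ε / 2 := add_le_add (hn i hi Γ hΓ) h1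
      _ = ε := by ring
  have hF0 : ∀ Γ, MeasurableSet Γ → 0 ≤ F Γ := fun Γ hΓ =>
    ge_of_tendsto' (hF Γ hΓ) fun n => measureReal_nonneg
  have hFempty : F ∅ = 0 :=
    tendsto_nhds_unique (hF ∅ MeasurableSet.empty) (by simp)
  have hFuniv : F Set.univ = 1 :=
    tendsto_nhds_unique (hF _ MeasurableSet.univ) (by simp)
  have hsum : ∀ f : ℕ → Set α, (∀ i, MeasurableSet (f i)) →
      Pairwise (Function.onFun Disjoint f) → HasSum (fun i => F (f i)) (F (⋃ i, f i)) := by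
    intro f hf hd
    have hpart : ∀ k, F (⋃ i ∈ Finset.range k, f i) = ∑ i ∈ Finset.range k, F (f i) := by
      intro k
      refine tendsto_nhds_unique (hF _ (Finset.measurableSet_biUnion _ fun i _ => hf i)) ?_
      have : ∀ n, (ρ n).real (⋃ i ∈ Finset.range k, f i) =
          ∑ i ∈ Finset.range k, (ρ n).real (f i) := fun n =>
        measureReal_biUnion_finset (fun i _ j _ hij => hd hij) fun i _ => hf i
      simp_rw [this]
      exact tendsto_finsetSum _ fun i _ => hF _ (hf i)
    rw [hasSum_iff_tendsto_nat_of_nonneg fun i => hF0 _ (hf i)]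
    simp_rw [← hpart]
    rw [Metric.tendsto_atTop]
    intro ε hε
    -- Countable additivity of the single measure `ρ n` transfers to `F`: the error `ε / 4` is paid
    -- once for the partial union, once for the full union and once for continuity of `ρ n` along
    -- the unions.
    obtain ⟨n, hn⟩ := hunif (ε / 4) (by positivity)
    have hρ : Tendsto (fun k => (ρ n).real (⋃ i ∈ Finset.range k, f i)) atTop
        (𝓝 ((ρ n).real (⋃ i, f i))) := by
      have h1 : HasSum (fun i => (ρ n).real (f i)) ((ρ n).real (⋃ i, f i)) := by
        have hne : ∑' i, ρ n (f i) ≠ ∞ := by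
          rw [← measure_iUnion hd hf]; exact measure_ne_top (ρ n) _
        rw [measureReal_def, measure_iUnion hd hf,
          ENNReal.tsum_toReal_eq (ENNReal.ne_top_of_tsum_ne_top hne)]
        exact ENNReal.hasSum_toReal hne
      have h2 := h1.tendsto_sum_nat
      refine h2.congr fun k => ?_
      exact (measureReal_biUnion_finset (fun i _ j _ hij => hd hij) fun i _ => hf i).symm
    obtain ⟨k, hk⟩ := Metric.tendsto_atTop.1 hρ (ε / 4) (by positivity)
    refine ⟨k, fun j hj => ?_⟩
    have e1 := hk j hj
    have e2 := hn n le_rfl (⋃ i ∈ Finset.range j, f i)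
      (Finset.measurableSet_biUnion _ fun i _ => hf i)
    have e3 := hn n le_rfl (⋃ i, f i) (MeasurableSet.iUnion hf)
    rw [Real.dist_eq] at e1 ⊢
    rw [abs_le] at e2 e3
    rw [abs_lt] at e1 ⊢
    constructor <;> linarith
  let μ : Measure α := Measure.ofMeasurable (fun Γ _ => ENNReal.ofReal (F Γ)) (by simp [hFempty])
    fun f hf hd => by
      rw [← (hsum f hf hd).tsum_eq,
        ENNReal.ofReal_tsum_of_nonneg (fun i => hF0 _ (hf i)) (hsum f hf hd).summable]
  have hμ : ∀ Γ, MeasurableSet Γ → μ Γ = ENNReal.ofReal (F Γ) := fun Γ hΓ =>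
    Measure.ofMeasurable_apply Γ hΓ
  refine ⟨μ, ⟨by rw [hμ _ MeasurableSet.univ, hFuniv]; simp⟩, fun ε hε => ?_⟩
  obtain ⟨n, hn⟩ := hunif ε hε
  refine ⟨n, fun i hi Γ hΓ => ?_⟩
  rw [show μ.real Γ = F Γ by rw [Measure.real, hμ Γ hΓ, ENNReal.toReal_ofReal (hF0 Γ hΓ)]]
  exact hn i hi Γ hΓ

end LimitMeasure

/-! ### Pullback construction of the equivariant family. -/

section Equivariant

variable {𝒴 : Type*} [MeasurableSpace 𝒴] {𝒳 : Type*} [MeasurableSpace 𝒳]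
  {X : (ℤ → 𝒴) → Set 𝒳} {P : Kernel ((ℤ → 𝒴) × 𝒳) 𝒳}

/-- The law at time `0` of the chain started at time `-n` from the law `ν` of that environment. -/
noncomputable def pulled (P : Kernel ((ℤ → 𝒴) × 𝒳) 𝒳) (ν : (ℤ → 𝒴) → Measure 𝒳) (n : ℕ)
    (ω : ℤ → 𝒴) : Measure 𝒳 :=
  iter P (shift (-(n : ℤ)) ω) n ∘ₘ ν (shift (-(n : ℤ)) ω)

theorem pulled_zero (P : Kernel ((ℤ → 𝒴) × 𝒳) 𝒳) (ν : (ℤ → 𝒴) → Measure 𝒳) :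
    pulled P ν 0 = ν := by
  funext ω
  simp [pulled, iter]

/-- Both sides start from the same environment `θ ^ (-n) ω`. In the limit `n → ∞` this recursion
becomes the equivariance of `μ`. -/
theorem pulled_succ_shift (P : Kernel ((ℤ → 𝒴) × 𝒳) 𝒳) (ν : (ℤ → 𝒴) → Measure 𝒳) (n : ℕ)
    (ω : ℤ → 𝒴) : pulled P ν (n + 1) (shift 1 ω) = P.sectR ω ∘ₘ pulled P ν n ω := by
  have hsh : shift (-((n + 1 : ℕ) : ℤ)) (shift 1 ω) = shift (-(n : ℤ)) ω := by
    rw [shift_shift]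
    congr 1
    push_cast
    ring
  rw [pulled, pulled, hsh, iter_add, shift_shift, Measure.comp_assoc]
  simp [iter]

theorem pulled_add (P : Kernel ((ℤ → 𝒴) × 𝒳) 𝒳) (ν : (ℤ → 𝒴) → Measure 𝒳) {i n : ℕ} (h : i ≤ n)
    (ω : ℤ → 𝒴) : pulled P ν n ω =
      iter P (shift (-(i : ℤ)) ω) i ∘ₘ pulled P ν (n - i) (shift (-(i : ℤ)) ω) := by
  have hsh : shift (-((n - i : ℕ) : ℤ)) (shift (-(i : ℤ)) ω) = shift (-(n : ℤ)) ω := by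
    rw [shift_shift]
    congr 1
    push_cast [h]
    ring
  rw [pulled, pulled, hsh, iter_neg_split P ω h, Measure.comp_assoc]

variable {Ω₀ : Set (ℤ → 𝒴)} {ν : (ℤ → 𝒴) → Measure 𝒳}

theorem pulled_prob (hP : IsTransitionFamily X P) (hinv : ∀ k : ℤ, ∀ ω ∈ Ω₀, shift k ω ∈ Ω₀)
    (hν : ∀ ω ∈ Ω₀, IsProbabilityMeasure (ν ω) ∧ ν ω (X ω)ᶜ = 0) (n : ℕ) {ω : ℤ → 𝒴}
    (hω : ω ∈ Ω₀) : IsProbabilityMeasure (pulled P ν n ω) ∧ pulled P ν n ω (X ω)ᶜ = 0 := by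
  have h := hν _ (hinv (-(n : ℤ)) ω hω)
  have := h.1
  exact (hP.mapsProb_iter_neg_self ω n).comp_measure (hP.measurableSet ω) h.2

/-- Induction through `pulled_succ_shift` requires only the joint measurability of the one-step
kernel. The vanishing of `ν` off `Ω₀` keeps all total masses at most `1`. -/
theorem measurable_pulled (hP : IsTransitionFamily X P)
    (hinv : ∀ k : ℤ, ∀ ω ∈ Ω₀, shift k ω ∈ Ω₀)
    (hν : ∀ ω ∈ Ω₀, IsProbabilityMeasure (ν ω) ∧ ν ω (X ω)ᶜ = 0) (hν0 : ∀ ω ∉ Ω₀, ν ω = 0)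
    (hνm : Measurable ν) (n : ℕ) : Measurable (pulled P ν n) := by
  induction n with
  | zero => rwa [pulled_zero]
  | succ n ih =>
    let κ : Kernel (ℤ → 𝒴) 𝒳 := ⟨pulled P ν n, ih⟩
    have : IsFiniteKernel κ := ⟨1, by simp, fun ω => by
      change pulled P ν n ω Set.univ ≤ 1
      by_cases hω : ω ∈ Ω₀
      · exact (pulled_prob hP hinv hν n hω).1.measure_univ.le
      · have : shift (-(n : ℤ)) ω ∉ Ω₀ := fun h => hω (by
          simpa [shift_shift] using hinv n _ h)
        rw [pulled, hν0 _ this]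
        simp⟩
    have heq : pulled P ν (n + 1) = (fun ω => P.sectR ω ∘ₘ κ ω) ∘ shift (-1) := by
      funext ω
      have := pulled_succ_shift P ν n (shift (-1) ω)
      rwa [shift_shift, show (1 : ℤ) + -1 = 0 by norm_num, shift_zero] at this
    rw [heq]
    refine Measurable.comp ?_ (measurable_shift _)
    refine Measure.measurable_of_measurable_coe _ fun Γ hΓ => ?_
    have : ∀ ω, (P.sectR ω ∘ₘ κ ω) Γ = ∫⁻ x, P (ω, x) Γ ∂κ ω := fun ω => by
      rw [Measure.bind_apply hΓ (Kernel.aemeasurable _)]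
      simp
    simp_rw [this]
    exact Measurable.lintegral_kernel_prod_right (f := fun ω x => P (ω, x) Γ)
      (P.measurable_coe hΓ)

/-- On an invariant set of environments along whose backward orbits the Dobrushin coefficients
tend to `0`, there is an equivariant family of probability measures. -/
theorem exists_equivariant_family (hP : IsTransitionFamily X P) (hΩ : MeasurableSet Ω₀)
    (hinv : ∀ k : ℤ, ∀ ω ∈ Ω₀, shift k ω ∈ Ω₀) {m : (ℤ → 𝒴) → Measure 𝒳}
    (hm : ∀ ω ∈ Ω₀, IsProbabilityMeasure (m ω) ∧ m ω (X ω)ᶜ = 0)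
    (hosc : ∀ ω ∈ Ω₀, ∀ ε > 0, ∃ n : ℕ,
      OscLE (iter P (shift (-(n : ℤ)) ω) n) (X (shift (-(n : ℤ)) ω)) ε) :
    ∃ μ : (ℤ → 𝒴) → Measure 𝒳,
      (∀ ω ∈ Ω₀, IsProbabilityMeasure (μ ω) ∧ μ ω (X ω)ᶜ = 0) ∧
      (∀ ω ∈ Ω₀, μ (shift 1 ω) = (P.sectR ω) ∘ₘ (μ ω)) ∧
      (Measurable m → Measurable μ) ∧
      ∀ ω ∈ Ω₀, ∀ (n : ℕ) (c : ℝ),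
        OscLE (iter P (shift (-(n : ℤ)) ω) n) (X (shift (-(n : ℤ)) ω)) c →
        ∀ x ∈ X (shift (-(n : ℤ)) ω), ∀ Γ, MeasurableSet Γ →
          |(iter P (shift (-(n : ℤ)) ω) n x).real Γ - (μ ω).real Γ| ≤ c := by
  classical
  -- Since `Ω₀` is invariant, the value `0` off `Ω₀` makes every pullback vanish there. The
  -- pullbacks then converge at every `ω`, which yields measurability of the limit without
  -- exceptional sets.
  set ν : (ℤ → 𝒴) → Measure 𝒳 := fun ω => if ω ∈ Ω₀ then m ω else 0 with hνdef
  have hν : ∀ ω ∈ Ω₀, IsProbabilityMeasure (ν ω) ∧ ν ω (X ω)ᶜ = 0 := fun ω hω => by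
    simp only [hνdef, if_pos hω]
    exact hm ω hω
  have hν0 : ∀ ω ∉ Ω₀, ν ω = 0 := fun ω hω => if_neg hω
  have hprob := fun n ω (hω : ω ∈ Ω₀) => pulled_prob hP hinv hν n hω
  -- comparison of the `n`-step transition with later pullbacks
  have hcmp : ∀ ω ∈ Ω₀, ∀ (n : ℕ) (c : ℝ),
      OscLE (iter P (shift (-(n : ℤ)) ω) n) (X (shift (-(n : ℤ)) ω)) c → ∀ i ≥ n,
      ∀ x ∈ X (shift (-(n : ℤ)) ω), ∀ Γ, MeasurableSet Γ →
        |(iter P (shift (-(n : ℤ)) ω) n x).real Γ - (pulled P ν i ω).real Γ| ≤ c := by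
    intro ω hω n c hc i hi x hx Γ hΓ
    have h := hprob (i - n) _ (hinv (-(n : ℤ)) ω hω)
    have := h.1
    rw [pulled_add P ν hi]
    exact hc.abs_sub_comp_measure_le (hP.mapsProb_iter_neg_self ω n) h.2 hx hΓ
  have hne : ∀ ω ∈ Ω₀, (X ω).Nonempty := fun ω hω => by
    rw [Set.nonempty_iff_ne_empty]
    intro he
    have h := hν ω hω
    have := h.1
    simp [he] at h
  have hex : ∀ ω ∈ Ω₀, ∃ μ : Measure 𝒳, IsProbabilityMeasure μ ∧
      ∀ ε > 0, ∃ n, ∀ i ≥ n, ∀ Γ, MeasurableSet Γ →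
        |(pulled P ν i ω).real Γ - μ.real Γ| ≤ ε := by
    intro ω hω
    have := fun n => (hprob n ω hω).1
    refine exists_uniform_limit_measure fun ε hε => ?_
    obtain ⟨n, hn⟩ := hosc ω hω (ε / 2) (by positivity)
    obtain ⟨x, hx⟩ := hne _ (hinv (-(n : ℤ)) ω hω)
    refine ⟨n, fun i hi Γ hΓ => ?_⟩
    have h1 := hcmp ω hω n _ hn i hi x hx Γ hΓ
    have h2 := hcmp ω hω n _ hn n le_rfl x hx Γ hΓ
    rw [abs_le] at h1 h2 ⊢
    constructor <;> linarith
  choose! μ₀ hμ₀ hμ₀lim using hex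
  set μ : (ℤ → 𝒴) → Measure 𝒳 := fun ω => if ω ∈ Ω₀ then μ₀ ω else 0 with hμdef
  have hμ : ∀ ω ∈ Ω₀, IsProbabilityMeasure (μ ω) := fun ω hω => by
    simp only [hμdef, if_pos hω]
    exact hμ₀ ω hω
  have hunif : ∀ ω ∈ Ω₀, ∀ ε > 0, ∃ n, ∀ i ≥ n, ∀ Γ, MeasurableSet Γ →
      |(pulled P ν i ω).real Γ - (μ ω).real Γ| ≤ ε := fun ω hω => by
    simp only [hμdef, if_pos hω]
    exact hμ₀lim ω hω
  have hlim : ∀ ω ∈ Ω₀, ∀ Γ, MeasurableSet Γ →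
      Tendsto (fun n => (pulled P ν n ω).real Γ) atTop (𝓝 ((μ ω).real Γ)) := by
    intro ω hω Γ hΓ
    rw [Metric.tendsto_atTop]
    intro ε hε
    obtain ⟨n, hn⟩ := hunif ω hω (ε / 2) (by positivity)
    exact ⟨n, fun i hi => by rw [Real.dist_eq]; linarith [hn i hi Γ hΓ]⟩
  have hconc : ∀ ω ∈ Ω₀, μ ω (X ω)ᶜ = 0 := fun ω hω => by
    have := hμ ω hω
    have h0 : (μ ω).real (X ω)ᶜ = 0 := by
      refine tendsto_nhds_unique (hlim ω hω _ (hP.measurableSet ω).compl) ?_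
      have : ∀ n, (pulled P ν n ω).real (X ω)ᶜ = 0 := fun n => by
        rw [Measure.real, (hprob n ω hω).2, ENNReal.toReal_zero]
      simp [this]
    rwa [measureReal_eq_zero_iff] at h0
  refine ⟨μ, fun ω hω => ⟨hμ ω hω, hconc ω hω⟩, fun ω hω => ?_, fun hmm => ?_, ?_⟩
  · have hω1 := hinv 1 ω hω
    have := hμ _ hω1
    have := hμ _ hω
    have hpush := (hP.mapsProb ω).comp_measure (hP.measurableSet _) (hconc ω hω)
    have := hpush.1
    refine Measure.ext fun Γ hΓ => ?_
    rw [← ENNReal.toReal_eq_toReal_iff' (measure_ne_top _ _) (measure_ne_top _ _)]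
    change (μ (shift 1 ω)).real Γ = (P.sectR ω ∘ₘ μ ω).real Γ
    refine tendsto_nhds_unique ((tendsto_add_atTop_iff_nat 1).2 (hlim _ hω1 Γ hΓ)) ?_
    simp_rw [pulled_succ_shift]
    rw [Metric.tendsto_atTop]
    intro ε hε
    obtain ⟨n, hn⟩ := hunif ω hω (ε / 2) (by positivity)
    refine ⟨n, fun i hi => ?_⟩
    have hpi := hprob i ω hω
    have := hpi.1
    -- Applying `P_ω` does not increase total variation distance, so the convergence to `μ ω`
    -- survives one more step.
    have hosc1 := (hP.mapsProb ω).oscLE_one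
    have h1 := hosc1.comp_measure (hP.mapsProb ω) hpi.2 (hconc ω hω) (t := ε / 2)
      (fun Γ hΓ => by linarith [(abs_le.1 (hn i hi Γ hΓ)).2]) hΓ
    have h2 := hosc1.comp_measure (hP.mapsProb ω) (hconc ω hω) hpi.2 (t := ε / 2)
      (fun Γ hΓ => by linarith [(abs_le.1 (hn i hi Γ hΓ)).1]) hΓ
    rw [Real.dist_eq, abs_lt]
    constructor <;> linarith
  · have hνm : Measurable ν := Measurable.ite hΩ hmm measurable_const
    refine Measure.measurable_of_measurable_coe _ fun Γ hΓ => ?_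
    have hreal : Measurable fun ω => (μ ω).real Γ := by
      refine measurable_of_tendsto_metrizable
        (f := fun n ω => (pulled P ν n ω).real Γ) (fun n => ?_) ?_
      · exact ((Measure.measurable_coe hΓ).comp
          (measurable_pulled hP hinv hν hν0 hνm n)).ennreal_toReal
      · rw [tendsto_pi_nhds]
        intro ω
        by_cases hω : ω ∈ Ω₀
        · exact hlim ω hω Γ hΓ
        · have : ∀ n : ℕ, pulled P ν n ω = 0 := fun n => by
            have : shift (-(n : ℤ)) ω ∉ Ω₀ := fun h => hω (by
              simpa [shift_shift] using hinv n _ h)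
            rw [pulled, hν0 _ this]
            simp
          simp [this, hμdef, hω]
    have : (fun ω => μ ω Γ) = fun ω => ENNReal.ofReal ((μ ω).real Γ) := by
      funext ω
      have : IsFiniteMeasure (μ ω) := by
        by_cases hω : ω ∈ Ω₀
        · have := hμ ω hω
          infer_instance
        · simp only [hμdef, if_neg hω]
          infer_instance
      rw [ofReal_measureReal]
    rw [this]
    exact hreal.ennreal_ofReal
  · intro ω hω n c hc x hx Γ hΓ
    refine le_of_tendsto (((hlim ω hω Γ hΓ).const_sub _).abs) ?_
    exact eventually_atTop.2 ⟨n, fun i hi => hcmp ω hω n c hc i hi x hx Γ hΓ⟩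

end Equivariant

/-! ### Decoupling past and future by mixing coefficients. -/

section Decoupling

variable {𝒴 : Type*} [MeasurableSpace 𝒴] {Pr : Measure (ℤ → 𝒴)} [IsProbabilityMeasure Pr]

theorem coordSigma_le (S : Set ℤ) : coordSigma 𝒴 S ≤ MeasurableSpace.pi :=
  iSup₂_le fun s _ => (measurable_pi_apply s).comap_le

theorem measurable_shift_coordSigma {S T : Set ℤ} {t : ℤ} (h : ∀ s ∈ S, s + t ∈ T) :
    Measurable[coordSigma 𝒴 T, coordSigma 𝒴 S] (shift t) := by
  rw [measurable_iff_comap_le]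
  simp only [coordSigma, MeasurableSpace.comap_iSup, MeasurableSpace.comap_comp]
  exact iSup₂_le fun s hs => le_iSup₂_of_le (s + t) (h s hs) le_rfl

theorem measurable_hits_coordSigma {G : Set (ℤ → 𝒴)} {S T : Set ℤ}
    (hG : MeasurableSet[coordSigma 𝒴 S] G) {L k : ℕ}
    (h : ∀ j < k, ∀ s ∈ S, s + -((j * L : ℕ) : ℤ) ∈ T) :
    Measurable[coordSigma 𝒴 T] (hits G L k) := by
  classical
  refine Finset.measurable_sum _ fun j hj => ?_
  exact Measurable.ite (measurable_shift_coordSigma (h j (Finset.mem_range.1 hj)) hG)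
    measurable_const measurable_const

theorem le_alphaMix {k : ℤ} {n : ℕ} {A B : Set (ℤ → 𝒴)}
    (hA : MeasurableSet[coordSigma 𝒴 (Set.Iic k)] A)
    (hB : MeasurableSet[coordSigma 𝒴 (Set.Ici (k + n))] B) :
    |Pr.real (A ∩ B) - Pr.real A * Pr.real B| ≤ alphaMix Pr n := by
  refine le_csSup ⟨1, ?_⟩ ⟨k, A, B, hA, hB, rfl⟩
  rintro _ ⟨k, A, B, -, -, rfl⟩
  have h1 : Pr.real A * Pr.real B ≤ 1 :=
    mul_le_one₀ measureReal_le_one measureReal_nonneg measureReal_le_one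
  have h2 : 0 ≤ Pr.real A * Pr.real B := by positivity
  rw [abs_le]
  constructor <;> linarith [measureReal_le_one (μ := Pr) (s := A ∩ B),
    measureReal_nonneg (μ := Pr) (s := A ∩ B)]

theorem alphaMix_nonneg (n : ℕ) : 0 ≤ alphaMix Pr n :=
  (abs_nonneg _).trans (le_alphaMix (Pr := Pr) (k := 0) (n := n) (A := ∅) (B := ∅)
    (@MeasurableSet.empty _ (_)) (@MeasurableSet.empty _ (_)))

theorem le_psiU {Pr : Measure (ℤ → 𝒴)} {k : ℤ} {n : ℕ} {A B : Set (ℤ → 𝒴)}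
    (hA : MeasurableSet[coordSigma 𝒴 (Set.Iic k)] A)
    (hB : MeasurableSet[coordSigma 𝒴 (Set.Ici (k + n))] B) (h : 0 < Pr.real A * Pr.real B) :
    ((Pr.real (A ∩ B) / (Pr.real A * Pr.real B) - 1 : ℝ) : EReal) ≤ psiU Pr n := by
  unfold psiU
  refine le_sSup ?_
  exact ⟨k, A, B, hA, hB, h, rfl⟩

theorem psiU_nonneg (n : ℕ) : 0 ≤ psiU Pr n := by
  have h := le_psiU (Pr := Pr) (k := 0) (n := n) (A := Set.univ) (B := Set.univ)
    (@MeasurableSet.univ _ (_)) (@MeasurableSet.univ _ (_)) (by simp)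
  simpa using h

theorem measureReal_inter_le_of_psiU_le {k : ℤ} {n : ℕ} {A B : Set (ℤ → 𝒴)} {s : ℝ}
    (hs : psiU Pr n ≤ s) (hA : MeasurableSet[coordSigma 𝒴 (Set.Iic k)] A)
    (hB : MeasurableSet[coordSigma 𝒴 (Set.Ici (k + n))] B) :
    Pr.real (A ∩ B) ≤ (1 + s) * Pr.real A * Pr.real B := by
  have h0 : 0 ≤ Pr.real A * Pr.real B := by positivity
  -- Pairs with a null set are excluded from the supremum defining `psiU`; for them the left side
  -- vanishes.
  rcases h0.eq_or_lt with h | h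
  · have : Pr.real (A ∩ B) = 0 := by
      rcases mul_eq_zero.1 h.symm with hz | hz
      · exact measureReal_mono_null Set.inter_subset_left hz
      · exact measureReal_mono_null Set.inter_subset_right hz
    rw [this, mul_assoc, ← h, mul_zero]
  · have h1 : ((Pr.real (A ∩ B) / (Pr.real A * Pr.real B) - 1 : ℝ) : EReal) ≤ s :=
      (le_psiU hA hB h).trans hs
    rw [EReal.coe_le_coe_iff, sub_le_iff_le_add, div_le_iff₀ h] at h1
    linarith

variable {g : (ℤ → 𝒴) → ℝ} {k : ℤ} {n : ℕ} {A : Set (ℤ → 𝒴)}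

/-- Each superlevel set of `g` is a future event, for which `α` compares `Pr(A) • Pr` with `Pr`
restricted to `A`. The layer-cake comparison passes from events to `g` without losing a constant. -/
theorem mul_integral_le_setIntegral_add_alphaMix
    (hg : Measurable[coordSigma 𝒴 (Set.Ici (k + n))] g) (h0 : ∀ ω, 0 ≤ g ω) (h1 : ∀ ω, g ω ≤ 1)
    (hA : MeasurableSet[coordSigma 𝒴 (Set.Iic k)] A) :
    Pr.real A * ∫ ω, g ω ∂Pr ≤ ∫ ω in A, g ω ∂Pr + alphaMix Pr n := by
  have h := integral_le_add_of_superlevel (ρ := (Pr A).toNNReal • Pr) (ρ' := Pr.restrict A)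
    (hg.mono (coordSigma_le _) le_rfl) h0 h1 zero_le_one (t := alphaMix Pr n) fun s => by
      have hm : MeasurableSet[coordSigma 𝒴 (Set.Ici (k + n))] {ω | s ≤ g ω} :=
        hg measurableSet_Ici
      rw [measureReal_restrict_apply (coordSigma_le _ _ hm), measureReal_nnreal_smul_apply,
        Set.inter_comm]
      have := (abs_le.1 (le_alphaMix (Pr := Pr) hA hm)).1
      change Pr.real A * _ ≤ _
      linarith
  rw [integral_smul_nnreal_measure, one_mul] at h
  exact h

theorem setIntegral_le_of_psiU_le {s : ℝ} (hs0 : 0 ≤ s) (hs : psiU Pr n ≤ s)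
    (hg : Measurable[coordSigma 𝒴 (Set.Ici (k + n))] g) (h0 : ∀ ω, 0 ≤ g ω) (h1 : ∀ ω, g ω ≤ 1)
    (hA : MeasurableSet[coordSigma 𝒴 (Set.Iic k)] A) :
    ∫ ω in A, g ω ∂Pr ≤ (1 + s) * Pr.real A * ∫ ω, g ω ∂Pr := by
  have hc : 0 ≤ (1 + s) * Pr.real A := by positivity
  have h := integral_le_add_of_superlevel (ρ' := ((1 + s) * Pr.real A).toNNReal • Pr)
    (ρ := Pr.restrict A)
    (hg.mono (coordSigma_le _) le_rfl) h0 h1 zero_le_one (t := 0) fun s' => by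
      have hm : MeasurableSet[coordSigma 𝒴 (Set.Ici (k + n))] {ω | s' ≤ g ω} :=
        hg measurableSet_Ici
      rw [measureReal_restrict_apply (coordSigma_le _ _ hm), measureReal_nnreal_smul_apply,
        Set.inter_comm, Real.coe_toNNReal _ hc, add_zero]
      exact measureReal_inter_le_of_psiU_le hs hA hm
  rw [integral_smul_nnreal_measure, mul_zero, add_zero, NNReal.smul_def,
    Real.coe_toNNReal _ hc] at h
  exact h

end Decoupling

/-! ### Exponential moments of the number of visits. -/

section Visits

variable {𝒴 : Type*} [MeasurableSpace 𝒴] {Pr : Measure (ℤ → 𝒴)} [IsProbabilityMeasure Pr]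
  {G : Set (ℤ → 𝒴)} {q : ℝ}

theorem integrable_pow_hits (hG : MeasurableSet G) (hq0 : 0 ≤ q) (hq1 : q ≤ 1) (L k : ℕ) :
    Integrable (fun ω => q ^ hits G L k ω) Pr :=
  Integrable.of_bound ((measurable_of_countable fun n : ℕ => q ^ n).comp
    (measurable_hits hG L k)).aestronglyMeasurable 1 (ae_of_all _ fun ω => by
      rw [Real.norm_eq_abs, abs_of_nonneg (by positivity)]
      exact pow_le_one₀ hq0 hq1)

theorem integral_pow_hits_succ (hG : MeasurableSet G) (hq0 : 0 ≤ q) (hq1 : q ≤ 1) (L k : ℕ) :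
    ∫ ω, q ^ hits G L (k + 1) ω ∂Pr = q * ∫ ω in shift (-((k * L : ℕ) : ℤ)) ⁻¹' G,
        q ^ hits G L k ω ∂Pr +
      ∫ ω in (shift (-((k * L : ℕ) : ℤ)) ⁻¹' G)ᶜ, q ^ hits G L k ω ∂Pr := by
  classical
  have hE : MeasurableSet (shift (-((k * L : ℕ) : ℤ)) ⁻¹' G) := measurable_shift _ hG
  rw [← integral_add_compl hE (integrable_pow_hits hG hq0 hq1 L (k + 1)), ← integral_const_mul]
  congr 1
  · refine setIntegral_congr_fun hE fun ω hω => ?_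
    have hω' : shift (-((k * L : ℕ) : ℤ)) ω ∈ G := hω
    simp only [hits_succ, if_pos hω', pow_succ]
    ring
  · refine setIntegral_congr_fun hE.compl fun ω hω => ?_
    have hω' : shift (-((k * L : ℕ) : ℤ)) ω ∉ G := hω
    simp only [hits_succ, if_neg hω', add_zero]

variable {r : ℕ}

/-- Sample `k` is the oldest and sees coordinates up to `-3 r k + r`. The samples `j < k` see
nothing before `-3 r (k - 1) - r = -3 r k + 2 r`, so spacing `3 r` leaves a gap of exactly `r`. -/
theorem measurable_pow_hits_future (hG : MeasurableSet[coordSigma 𝒴 (Set.Icc (-(r : ℤ)) r)] G)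
    (k : ℕ) : Measurable[coordSigma 𝒴 (Set.Ici (-((k * (3 * r) : ℕ) : ℤ) + r + r))]
      fun ω => q ^ hits G (3 * r) k ω := by
  refine (measurable_of_countable fun n : ℕ => q ^ n).comp
    (measurable_hits_coordSigma hG fun j hj s hs => ?_)
  rw [Set.mem_Icc] at hs
  rw [Set.mem_Ici]
  have : (j + 1) * (3 * r) ≤ k * (3 * r) := Nat.mul_le_mul_right _ hj
  zify at this ⊢
  linarith [hs.1]

theorem measurableSet_shift_past (hG : MeasurableSet[coordSigma 𝒴 (Set.Icc (-(r : ℤ)) r)] G)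
    (i : ℤ) : MeasurableSet[coordSigma 𝒴 (Set.Iic (i + r))] (shift i ⁻¹' G) :=
  measurable_shift_coordSigma (fun s hs => by
    rw [Set.mem_Iic]
    linarith [hs.2]) hG

/-- Let `e_k` be the left side and `c = 1 - (1 - q) Pr(G)`. Splitting off the oldest sample and
decoupling it gives `e_{k+1} ≤ c e_k + α(r)`; as `c ≤ 1`, the errors add up to at most `k α(r)`. -/
theorem integral_pow_hits_le_alphaMix (hstat : MeasurePreserving (shift 1) Pr Pr)
    (hG : MeasurableSet[coordSigma 𝒴 (Set.Icc (-(r : ℤ)) r)] G) (hq0 : 0 ≤ q) (hq1 : q ≤ 1)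
    (k : ℕ) :
    ∫ ω, q ^ hits G (3 * r) k ω ∂Pr ≤ (1 - (1 - q) * Pr.real G) ^ k + k * alphaMix Pr r := by
  have hGm := coordSigma_le _ _ hG
  have hp0 : 0 ≤ Pr.real G := measureReal_nonneg
  have hp1 : Pr.real G ≤ 1 := measureReal_le_one
  have hα := alphaMix_nonneg (Pr := Pr) r
  induction k with
  | zero => simp [hits]
  | succ k ih =>
    set E := shift (-((k * (3 * r) : ℕ) : ℤ)) ⁻¹' G with hE
    have hEp : Pr.real E = Pr.real G :=
      (measurePreserving_shift hstat _).measureReal_preimage hGm.nullMeasurableSet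
    have h1 := mul_integral_le_setIntegral_add_alphaMix (Pr := Pr)
      (measurable_pow_hits_future (q := q) hG k) (fun ω => by positivity)
      (fun ω => pow_le_one₀ hq0 hq1) (measurableSet_shift_past hG (-((k * (3 * r) : ℕ) : ℤ)))
    rw [← hE, hEp] at h1
    have h2 := integral_add_compl (measurable_shift (-((k * (3 * r) : ℕ) : ℤ)) hGm)
      (integrable_pow_hits (Pr := Pr) hGm hq0 hq1 (3 * r) k)
    rw [← hE] at h2
    rw [integral_pow_hits_succ hGm hq0 hq1, ← hE]
    set e := ∫ ω, q ^ hits G (3 * r) k ω ∂Pr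
    set c := 1 - (1 - q) * Pr.real G with hc
    have hc0 : 0 ≤ c := by nlinarith
    have hc1 : c ≤ 1 := by nlinarith
    have h3 : c * e ≤ c * (c ^ k + k * alphaMix Pr r) := mul_le_mul_of_nonneg_left ih hc0
    have h4 : c * (k * alphaMix Pr r) ≤ k * alphaMix Pr r := mul_le_of_le_one_left (by positivity) hc1
    have h5 : (1 - q) * (Pr.real G * e) ≤
        (1 - q) * (∫ ω in E, q ^ hits G (3 * r) k ω ∂Pr + alphaMix Pr r) :=
      mul_le_mul_of_nonneg_left h1 (by linarith)
    have h6 : (1 - q) * alphaMix Pr r ≤ alphaMix Pr r := mul_le_of_le_one_left hα (by linarith)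
    rw [pow_succ]
    push_cast
    have h7 : c * e = e - (1 - q) * (Pr.real G * e) := by rw [hc]; ring
    nlinarith

/-- Decoupling is applied both to the event that the oldest sample hits `G` and to its complement.
Each costs a factor `1 + s`, so there is no additive error. -/
theorem integral_pow_hits_le_psiU (hstat : MeasurePreserving (shift 1) Pr Pr)
    (hG : MeasurableSet[coordSigma 𝒴 (Set.Icc (-(r : ℤ)) r)] G) (hq0 : 0 ≤ q) (hq1 : q ≤ 1)
    {s : ℝ} (hs0 : 0 ≤ s) (hs : psiU Pr r ≤ s) (k : ℕ) :
    ∫ ω, q ^ hits G (3 * r) k ω ∂Pr ≤ ((1 + s) * (1 - (1 - q) * Pr.real G)) ^ k := by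
  have hGm := coordSigma_le _ _ hG
  have hp0 : 0 ≤ Pr.real G := measureReal_nonneg
  have hp1 : Pr.real G ≤ 1 := measureReal_le_one
  induction k with
  | zero => simp [hits]
  | succ k ih =>
    set E := shift (-((k * (3 * r) : ℕ) : ℤ)) ⁻¹' G with hE
    have hEm : MeasurableSet E := measurable_shift _ hGm
    have hEp : Pr.real E = Pr.real G :=
      (measurePreserving_shift hstat _).measureReal_preimage hGm.nullMeasurableSet
    have hpast := measurableSet_shift_past hG (-((k * (3 * r) : ℕ) : ℤ))
    have h1 := setIntegral_le_of_psiU_le hs0 hs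
      (measurable_pow_hits_future (q := q) hG k) (fun ω => by positivity)
      (fun ω => pow_le_one₀ hq0 hq1) hpast
    have h2 := setIntegral_le_of_psiU_le hs0 hs
      (measurable_pow_hits_future (q := q) hG k) (fun ω => by positivity)
      (fun ω => pow_le_one₀ hq0 hq1) (@MeasurableSet.compl _ _ (_) hpast)
    rw [← hE, hEp] at h1
    rw [← hE, probReal_compl_eq_one_sub hEm, hEp] at h2
    rw [integral_pow_hits_succ hGm hq0 hq1, ← hE]
    set e := ∫ ω, q ^ hits G (3 * r) k ω ∂Pr
    set c := (1 + s) * (1 - (1 - q) * Pr.real G) with hc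
    have hc0 : 0 ≤ c := mul_nonneg (by linarith) (by nlinarith)
    have h3 : c * e ≤ c * c ^ k := mul_le_mul_of_nonneg_left ih hc0
    have h4 := mul_le_mul_of_nonneg_left h1 hq0
    rw [pow_succ]
    have h5 : c * e = q * ((1 + s) * Pr.real G * e) + (1 + s) * (1 - Pr.real G) * e := by
      rw [hc]; ring
    linarith

/-- Replacing `G` by a set contained in `G ∪ B`. -/
theorem integral_pow_hits_le_add (hstat : MeasurePreserving (shift 1) Pr Pr)
    {G' B : Set (ℤ → 𝒴)} (hG : MeasurableSet G) (hG' : MeasurableSet G') (hB : MeasurableSet B)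
    (hsub : G' ⊆ G ∪ B) (hq0 : 0 ≤ q) (hq1 : q ≤ 1) (L k : ℕ) :
    ∫ ω, q ^ hits G L k ω ∂Pr ≤ ∫ ω, q ^ hits G' L k ω ∂Pr + k * Pr.real B := by
  classical
  set U : Set (ℤ → 𝒴) := ⋃ j ∈ Finset.range k, shift (-((j * L : ℕ) : ℤ)) ⁻¹' B with hU
  have hUm : MeasurableSet U := Finset.measurableSet_biUnion _ fun j _ => measurable_shift _ hB
  have hUp : Pr.real U ≤ k * Pr.real B := by
    calc Pr.real U ≤ ∑ j ∈ Finset.range k, Pr.real (shift (-((j * L : ℕ) : ℤ)) ⁻¹' B) :=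
          measureReal_biUnion_finset_le _ _
      _ = ∑ _j ∈ Finset.range k, Pr.real B := Finset.sum_congr rfl fun j _ =>
          (measurePreserving_shift hstat _).measureReal_preimage hB.nullMeasurableSet
      _ = k * Pr.real B := by simp
  have hpt : ∀ ω, q ^ hits G L k ω ≤ q ^ hits G' L k ω + U.indicator 1 ω := by
    intro ω
    by_cases hω : ω ∈ U
    · rw [Set.indicator_of_mem hω]
      have : q ^ hits G L k ω ≤ 1 := pow_le_one₀ hq0 hq1
      have : 0 ≤ q ^ hits G' L k ω := by positivity
      simp only [Pi.one_apply]
      linarith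
    · rw [Set.indicator_of_notMem hω, add_zero]
      refine pow_le_pow_of_le_one hq0 hq1 (Finset.sum_le_sum fun j hj => ?_)
      split
      next h =>
        have : shift (-((j * L : ℕ) : ℤ)) ω ∉ B := fun h' =>
          hω (Set.mem_biUnion (Finset.mem_coe.2 hj) h')
        rw [if_pos ((hsub h).resolve_right this)]
      next => exact Nat.zero_le _
  have hind : Integrable (U.indicator (1 : (ℤ → 𝒴) → ℝ)) Pr :=
    (integrable_const (1 : ℝ)).indicator hUm
  calc ∫ ω, q ^ hits G L k ω ∂Pr
      ≤ ∫ ω, (q ^ hits G' L k ω + U.indicator 1 ω) ∂Pr :=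
        integral_mono (integrable_pow_hits hG hq0 hq1 L k)
          ((integrable_pow_hits hG' hq0 hq1 L k).add hind) hpt
    _ = ∫ ω, q ^ hits G' L k ω ∂Pr + Pr.real U := by
        rw [integral_add (integrable_pow_hits hG' hq0 hq1 L k) hind, integral_indicator_one hUm]
    _ ≤ _ := by gcongr

/-- Comparing powers with different bases: either there are at least `ε k` hits, or
`q' ^ (hits - ε k) ≥ 1`. -/
theorem pow_le_rpow_add_rpow_mul_pow {q q' ε : ℝ} (hq0 : 0 < q) (hq1 : q ≤ 1) (hq0' : 0 < q')
    (hq1' : q' ≤ 1) (k h : ℕ) : q ^ h ≤ (q ^ ε) ^ k + ((q' ^ ε)⁻¹) ^ k * q' ^ h := by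
  have e1 : (q ^ ε) ^ k = q ^ (ε * k) := by rw [Real.rpow_mul_natCast hq0.le]
  have e2 : ((q' ^ ε)⁻¹) ^ k * q' ^ h = q' ^ ((h : ℝ) - ε * k) := by
    rw [Real.rpow_sub hq0', Real.rpow_natCast, Real.rpow_mul_natCast hq0'.le, inv_pow]
    ring
  rcases le_total (ε * k) h with hle | hle
  · have : q ^ h ≤ (q ^ ε) ^ k := by
      rw [e1, ← Real.rpow_natCast]
      exact Real.rpow_le_rpow_of_exponent_ge hq0 hq1 hle
    have : 0 ≤ ((q' ^ ε)⁻¹) ^ k * q' ^ h := by positivity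
    linarith
  · have : 1 ≤ ((q' ^ ε)⁻¹) ^ k * q' ^ h := by
      rw [e2]
      exact Real.one_le_rpow_of_pos_of_le_one_of_nonpos hq0' hq1' (by linarith)
    have : 0 ≤ (q ^ ε) ^ k := by positivity
    have : q ^ h ≤ 1 := pow_le_one₀ hq0.le hq1
    linarith

end Visits

/-! ### The random constant and its moments. -/

section

variable {𝒴 : Type*} [MeasurableSpace 𝒴] {Pr : Measure (ℤ → 𝒴)} [IsProbabilityMeasure Pr]
  {N : (ℤ → 𝒴) → ℕ} {γ : (ℤ → 𝒴) → ℝ} {δ : ℝ} {M : ℕ} {A B : ℕ → Set (ℤ → 𝒴)} {b : ℕ → ℝ}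
  {p₀ : ℝ}

theorem exists_real_bound_of_limsup_mul_lt {u : ℕ → EReal} (h0 : ∀ n, 0 ≤ u n) {w : ℝ}
    (hw : 0 < w) (h : (1 + limsup u atTop) * (w : EReal) < 1) :
    ∃ s : ℝ, 0 ≤ s ∧ (1 + s) * w < 1 ∧ ∀ᶠ n in atTop, u n ≤ s := by
  have hl0 : 0 ≤ limsup u atTop := le_limsup_of_frequently_le (Frequently.of_forall h0)
  have htop : limsup u atTop ≠ ⊤ := by
    intro ht
    rw [ht, EReal.add_top_of_ne_bot (by decide), EReal.top_mul_of_pos (by exact_mod_cast hw)] at h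
    exact absurd h (by simp)
  have hbot : limsup u atTop ≠ ⊥ := fun hb => by simp [hb] at hl0
  obtain ⟨l, hl⟩ : ∃ l : ℝ, limsup u atTop = l := ⟨_, (EReal.coe_toReal htop hbot).symm⟩
  rw [hl] at h hl0
  have h' : (1 + l) * w < 1 := by exact_mod_cast h
  have hl0' : 0 ≤ l := by exact_mod_cast hl0
  have hlt : l < 1 / w - 1 := by
    rw [lt_sub_iff_add_lt, lt_div_iff₀ hw]
    linarith
  obtain ⟨s, hs1, hs2⟩ := exists_between hlt
  refine ⟨s, by linarith, ?_, ?_⟩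
  · rw [lt_sub_iff_add_lt, lt_div_iff₀ hw] at hs2
    linarith
  · have : limsup u atTop < (s : EReal) := by rw [hl]; exact_mod_cast hs1
    exact (eventually_lt_of_limsup_lt this).mono fun n hn => hn.le

theorem EnvAssumption.b_nonneg {Pr : Measure (ℤ → 𝒴)}
    (hA : EnvAssumption Pr N γ δ M A B b p₀) (r : ℕ) : 0 ≤ b r :=
  measureReal_nonneg.trans (hA.prob_B r)

theorem measurableSet_goodSet (hN : Measurable N) (hγ : Measurable γ) (δ : ℝ) (M : ℕ) :
    MeasurableSet (goodSet N γ δ M) :=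
  (measurableSet_le measurable_const hγ).inter (measurableSet_le hN measurable_const)

/-- The exponential moments of the number of visits to the good set, sampled at spacing `3 r`. -/
theorem EnvAssumption.integral_pow_hits_le (hA : EnvAssumption Pr N γ δ M A B b p₀)
    (hstat : MeasurePreserving (shift 1) Pr Pr) (hN : Measurable N) (hγ : Measurable γ)
    (hδ : δ < 1) {q : ℝ} (hq0 : 0 < q) (hq1 : q < 1) :
    ∃ ρ C : ℝ, 0 < ρ ∧ ρ < 1 ∧ 0 ≤ C ∧ ∀ᶠ r : ℕ in atTop, ∀ k : ℕ,
      ∫ ω, q ^ hits (goodSet N γ δ M) (3 * r) k ω ∂Pr ≤ C * (ρ ^ k + k * (r * b r)) := by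
  have hG := measurableSet_goodSet hN hγ δ M
  have hAm : ∀ r, MeasurableSet (A r) := fun r => coordSigma_le _ _ (hA.local_A r)
  have hp1 : p₀ ≤ 1 := le_of_tendsto' hA.tendsto_A fun r => measureReal_le_one
  have hp0 := hA.p₀_pos
  have hδ0 := hA.delta_pos
  have hcmp : ∀ q : ℝ, 0 < q → q < 1 → ∀ r : ℕ, 1 ≤ r → ∀ k : ℕ,
      ∫ ω, q ^ hits (goodSet N γ δ M) (3 * r) k ω ∂Pr ≤
        ∫ ω, q ^ hits (A r) (3 * r) k ω ∂Pr + k * (r * b r) := by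
    intro q hq0 hq1 r hr k
    refine (integral_pow_hits_le_add hstat hG (hAm r) (hA.measurable_B r) (hA.subset r)
      hq0.le hq1.le (3 * r) k).trans ?_
    -- The factor `r` is given away so that this error has the form of the `α`-mixing error.
    have h1 : Pr.real (B r) ≤ r * b r := (hA.prob_B r).trans
      (le_mul_of_one_le_left (hA.b_nonneg r) (by exact_mod_cast hr))
    gcongr
  rcases hA.mixing_rate with hα | hψ
  · obtain ⟨C, hC⟩ := hα.bound
    refine ⟨1 - (1 - q) * (p₀ / 2), 1 + |C|, by nlinarith, by nlinarith, by positivity, ?_⟩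
    filter_upwards [hC, hA.tendsto_A.eventually (lt_mem_nhds (show p₀ / 2 < p₀ by linarith)),
      eventually_ge_atTop 1] with r h1 h2 h3 k
    have hb : 0 ≤ (r : ℝ) * b r := mul_nonneg (by positivity) (hA.b_nonneg r)
    rw [Real.norm_of_nonneg (alphaMix_nonneg r), Real.norm_of_nonneg hb] at h1
    have h4 := integral_pow_hits_le_alphaMix hstat (hA.local_A r) hq0.le hq1.le k
    have h5 : (1 - (1 - q) * Pr.real (A r)) ^ k ≤ (1 - (1 - q) * (p₀ / 2)) ^ k := by
      have : Pr.real (A r) ≤ 1 := measureReal_le_one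
      refine pow_le_pow_left₀ (by nlinarith) ?_ k
      nlinarith
    have h6 : (k : ℝ) * alphaMix Pr r ≤ k * (|C| * (r * b r)) := by
      gcongr
      exact h1.trans (mul_le_mul_of_nonneg_right (le_abs_self C) hb)
    have h7 := hcmp q hq0 hq1 r h3 k
    have h8 : 0 ≤ |C| * (1 - (1 - q) * (p₀ / 2)) ^ k :=
      mul_nonneg (abs_nonneg _) (pow_nonneg (by nlinarith) k)
    linarith
  · set v := 1 - p₀ * (1 - δ) with hv
    have hv0 : 0 < v := by rw [hv]; nlinarith
    obtain ⟨s, hs0, hs1, hs⟩ := exists_real_bound_of_limsup_mul_lt (psiU_nonneg (Pr := Pr)) hv0 hψ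
    obtain ⟨ρ, hρ, hρ1⟩ := exists_between hs1
    have hρ0 : 0 < ρ := lt_trans (by positivity) hρ
    -- The hypothesis on `ψ_U` controls `E[δ ^ hits]` by `ρ ^ k`, but base `q` is needed. With `ε`
    -- defined by `δ ^ ε = σ = √ρ`, the change of base costs `σ⁻¹ ^ k`, which leaves `σ ^ k`; the
    -- event of at least `ε k` hits contributes `(q ^ ε) ^ k`.
    set σ := Real.sqrt ρ with hσ
    have hσ0 : 0 < σ := Real.sqrt_pos.2 hρ0
    have hσ1 : σ < 1 := by rw [hσ, Real.sqrt_lt' one_pos]; simpa using hρ1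
    have hσρ : σ⁻¹ * ρ = σ := by
      rw [← Real.mul_self_sqrt hρ0.le, ← hσ]
      field_simp
    set ε := Real.log σ / Real.log δ with hε
    have hε0 : 0 < ε := div_pos_of_neg_of_neg (Real.log_neg hσ0 hσ1) (Real.log_neg hδ0 hδ)
    have hδε : δ ^ ε = σ := by
      rw [Real.rpow_def_of_pos hδ0, hε, mul_div_cancel₀ _ (Real.log_neg hδ0 hδ).ne,
        Real.exp_log hσ0]
    have hqε : q ^ ε < 1 := Real.rpow_lt_one hq0.le hq1 hε0
    have hlim : Tendsto (fun r => (1 + s) * (1 - (1 - δ) * Pr.real (A r))) atTop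
        (𝓝 ((1 + s) * (1 - (1 - δ) * p₀))) :=
      (((hA.tendsto_A.const_mul _).const_sub 1).const_mul _)
    refine ⟨max (q ^ ε) σ, 2, lt_max_of_lt_right hσ0, max_lt hqε hσ1, by positivity, ?_⟩
    filter_upwards [hs, hlim.eventually (gt_mem_nhds (show _ < ρ by rw [mul_comm (1 - δ)]; exact hρ)),
      eventually_ge_atTop 1] with r h1 h2 h3 k
    have hb : 0 ≤ (r : ℝ) * b r := mul_nonneg (by positivity) (hA.b_nonneg r)
    have h4 := integral_pow_hits_le_psiU hstat (hA.local_A r) hδ0.le hδ.le hs0 h1 k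
    have h5 : ((1 + s) * (1 - (1 - δ) * Pr.real (A r))) ^ k ≤ ρ ^ k := by
      have h6 : Pr.real (A r) ≤ 1 := measureReal_le_one
      have h7 : 0 ≤ Pr.real (A r) := measureReal_nonneg
      exact pow_le_pow_left₀ (mul_nonneg (by linarith) (by nlinarith)) h2.le k
    have h6 : ∫ ω, q ^ hits (A r) (3 * r) k ω ∂Pr ≤
        (q ^ ε) ^ k + σ⁻¹ ^ k * ∫ ω, δ ^ hits (A r) (3 * r) k ω ∂Pr := by
      have hi := (integrable_pow_hits (Pr := Pr) (hAm r) hδ0.le hδ.le (3 * r) k).const_mul (σ⁻¹ ^ k)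
      calc ∫ ω, q ^ hits (A r) (3 * r) k ω ∂Pr
          ≤ ∫ ω, ((q ^ ε) ^ k + σ⁻¹ ^ k * δ ^ hits (A r) (3 * r) k ω) ∂Pr :=
            integral_mono (integrable_pow_hits (hAm r) hq0.le hq1.le _ _)
              ((integrable_const _).add hi) fun ω => by
                have := pow_le_rpow_add_rpow_mul_pow (ε := ε) hq0 hq1.le hδ0 hδ.le k
                  (hits (A r) (3 * r) k ω)
                rwa [hδε] at this
        _ = _ := by
            rw [integral_add (integrable_const _) hi, integral_const_mul]
            simp
    have h7 : σ⁻¹ ^ k * ∫ ω, δ ^ hits (A r) (3 * r) k ω ∂Pr ≤ σ ^ k := by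
      calc σ⁻¹ ^ k * ∫ ω, δ ^ hits (A r) (3 * r) k ω ∂Pr ≤ σ⁻¹ ^ k * ρ ^ k := by
            gcongr
            exact h4.trans h5
        _ = σ ^ k := by rw [← mul_pow, hσρ]
    have h8 : (q ^ ε) ^ k ≤ max (q ^ ε) σ ^ k := by gcongr; exact le_max_left _ _
    have h9 : σ ^ k ≤ max (q ^ ε) σ ^ k := by gcongr; exact le_max_right _ _
    have h10 := hcmp q hq0 hq1 r h3 k
    have h11 : 0 ≤ (k : ℝ) * (r * b r) := by positivity
    have h12 : 0 ≤ max (q ^ ε) σ ^ k := h9.trans' (by positivity)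
    linarith

theorem EnvAssumption.delta_lt_one {Pr : Measure (ℤ → 𝒴)} (hA : EnvAssumption Pr N γ δ M A B b p₀)
    (h : ∀ᵐ ω ∂Pr, γ ω < 1) : δ < 1 := by
  by_contra hδ
  refine hA.good_pos.ne' (measure_mono_null (fun ω hω => ?_) h)
  have : δ ≤ γ ω := hω.1
  exact fun h' : γ ω < 1 => by linarith

open scoped Classical in
/-- The contraction factor obtained from `k` samples of the backward orbit at spacing `3 r`. -/
noncomputable def decayFactor (N : (ℤ → 𝒴) → ℕ) (γ : (ℤ → 𝒴) → ℝ) (δ : ℝ) (M k r : ℕ)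
    (ω : ℤ → 𝒴) : ℝ :=
  if M ≤ 3 * r then (1 - δ) ^ hits (goodSet N γ δ M) (3 * r) k ω else 1

theorem measurable_decayFactor (hN : Measurable N) (hγ : Measurable γ) (δ : ℝ) (M k r : ℕ) :
    Measurable (decayFactor N γ δ M k r) := by
  unfold decayFactor
  split
  · exact (measurable_of_countable fun n : ℕ => (1 - δ) ^ n).comp
      (measurable_hits (measurableSet_goodSet hN hγ δ M) _ _)
  · exact measurable_const

theorem decayFactor_nonneg {𝒴 : Type*} {N : (ℤ → 𝒴) → ℕ} {γ : (ℤ → 𝒴) → ℝ}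
    (hδ : δ < 1) (k r : ℕ) (ω : ℤ → 𝒴) :
    0 ≤ decayFactor N γ δ M k r ω := by
  have : 0 ≤ 1 - δ := by linarith
  unfold decayFactor
  split <;> positivity

/-- The random constant associated with the weights `w` and the sampling parameters `k`, `r`. -/
noncomputable def rateConst (N : (ℤ → 𝒴) → ℕ) (γ : (ℤ → 𝒴) → ℝ) (δ : ℝ) (M : ℕ) (w : ℕ → ℝ)
    (k r : ℕ → ℕ) (ω : ℤ → 𝒴) : ℝ≥0∞ :=
  ⨆ n, ENNReal.ofReal (w n * decayFactor N γ δ M (k n) (r n) ω)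

theorem measurable_rateConst (hN : Measurable N) (hγ : Measurable γ) (δ : ℝ) (M : ℕ) (w : ℕ → ℝ)
    (k r : ℕ → ℕ) : Measurable (rateConst N γ δ M w k r) :=
  Measurable.iSup fun n => ((measurable_decayFactor hN hγ δ M _ _).const_mul (w n)).ennreal_ofReal

theorem EnvAssumption.lintegral_rateConst_lt_top (hA : EnvAssumption Pr N γ δ M A B b p₀)
    (hstat : MeasurePreserving (shift 1) Pr Pr) (hN : Measurable N) (hγ : Measurable γ)
    (hδ : δ < 1) {w : ℕ → ℝ} (hw : ∀ n, 0 ≤ w n) {k r : ℕ → ℕ} (hr : Tendsto r atTop atTop)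
    {d : ℝ} (hd : 0 < d)
    (hsum : ∀ ρ : ℝ, 0 < ρ → ρ < 1 →
      Summable fun n => w n ^ d * (ρ ^ k n + k n * (r n * b (r n)))) :
    ∫⁻ ω, rateConst N γ δ M w k r ω ^ d ∂Pr < ∞ := by
  have hδ0 := hA.delta_pos
  -- With this base, the `d`-th power of `(1 - δ) ^ hits` is `q ^ hits`.
  set q : ℝ := (1 - δ) ^ d with hq
  have hq0 : 0 < q := Real.rpow_pos_of_pos (by linarith) _
  have hq1 : q < 1 := Real.rpow_lt_one (by linarith) (by linarith) hd
  obtain ⟨ρ, C, hρ0, hρ1, hC, hest⟩ := hA.integral_pow_hits_le hstat hN hγ hδ hq0 hq1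
  have hG := measurableSet_goodSet hN hγ δ M
  set f : ℕ → (ℤ → 𝒴) → ℝ := fun n ω => w n * decayFactor N γ δ M (k n) (r n) ω with hf
  have hf0 : ∀ n ω, 0 ≤ f n ω := fun n ω => mul_nonneg (hw n) (decayFactor_nonneg hδ _ _ _)
  have hfm : ∀ n, Measurable (f n) := fun n =>
    (measurable_decayFactor hN hγ δ M _ _).const_mul (w n)
  have hle1 : ∀ n ω, decayFactor N γ δ M (k n) (r n) ω ≤ 1 := fun n ω => by
    unfold decayFactor
    split
    · exact pow_le_one₀ (by linarith) (by linarith)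
    · exact le_rfl
  have hfd : ∀ n ω, f n ω ^ d = w n ^ d * decayFactor N γ δ M (k n) (r n) ω ^ d := fun n ω =>
    Real.mul_rpow (hw n) (decayFactor_nonneg hδ _ _ _)
  have hfint : ∀ n, Integrable (fun ω => f n ω ^ d) Pr := fun n => by
    refine Integrable.of_bound ((hfm n).pow_const d).aestronglyMeasurable (w n ^ d)
      (ae_of_all _ fun ω => ?_)
    rw [Real.norm_of_nonneg (Real.rpow_nonneg (hf0 n ω) _), hfd]
    exact mul_le_of_le_one_right (Real.rpow_nonneg (hw n) _)
      (Real.rpow_le_one (decayFactor_nonneg hδ _ _ _) (hle1 n ω) hd.le)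
  have hS : Summable fun n => ∫ ω, f n ω ^ d ∂Pr := by
    refine Summable.of_norm_bounded_eventually_nat ((hsum ρ hρ0 hρ1).mul_left C) ?_
    filter_upwards [hr.eventually hest, hr.eventually (eventually_ge_atTop M)] with n h1 h2
    rw [Real.norm_of_nonneg (integral_nonneg fun ω => Real.rpow_nonneg (hf0 n ω) _)]
    have : ∀ ω, f n ω ^ d = w n ^ d * q ^ hits (goodSet N γ δ M) (3 * r n) (k n) ω := fun ω => by
      rw [hfd, decayFactor, if_pos (by omega), hq, ← Real.rpow_natCast, ← Real.rpow_natCast,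
        ← Real.rpow_mul (by linarith), ← Real.rpow_mul (by linarith), mul_comm d]
    simp_rw [this]
    rw [integral_const_mul]
    calc w n ^ d * ∫ ω, q ^ hits (goodSet N γ δ M) (3 * r n) (k n) ω ∂Pr
        ≤ w n ^ d * (C * (ρ ^ k n + k n * (r n * b (r n)))) :=
          mul_le_mul_of_nonneg_left (h1 (k n)) (Real.rpow_nonneg (hw n) _)
      _ = _ := by ring
  have hpt : ∀ ω, rateConst N γ δ M w k r ω ^ d ≤ ∑' n, ENNReal.ofReal (f n ω ^ d) := by
    intro ω
    rw [← ENNReal.le_rpow_inv_iff hd]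
    refine iSup_le fun n => ?_
    rw [ENNReal.le_rpow_inv_iff hd, ENNReal.ofReal_rpow_of_nonneg (hf0 n ω) hd.le]
    exact ENNReal.le_tsum n
  calc ∫⁻ ω, rateConst N γ δ M w k r ω ^ d ∂Pr
      ≤ ∫⁻ ω, ∑' n, ENNReal.ofReal (f n ω ^ d) ∂Pr := lintegral_mono hpt
    _ = ∑' n, ∫⁻ ω, ENNReal.ofReal (f n ω ^ d) ∂Pr :=
        lintegral_tsum fun n => ((hfm n).pow_const d).ennreal_ofReal.aemeasurable
    _ = ∑' n, ENNReal.ofReal (∫ ω, f n ω ^ d ∂Pr) := by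
        congr 1
        funext n
        exact (ofReal_integral_eq_lintegral_ofReal (hfint n)
          (ae_of_all _ fun ω => Real.rpow_nonneg (hf0 n ω) _)).symm
    _ < ∞ := hS.tsum_ofReal_lt_top

variable {𝒳 : Type*} [MeasurableSpace 𝒳] {X : (ℤ → 𝒴) → Set 𝒳}
  {P : Kernel ((ℤ → 𝒴) × 𝒳) 𝒳} {m : (ℤ → 𝒴) → Measure 𝒳}

/-- A random rate of decay of the Dobrushin coefficients along the backward orbit. -/
theorem EnvAssumption.exists_rate (hA : EnvAssumption Pr N γ δ M A B b p₀)
    (hstat : MeasurePreserving (shift 1) Pr Pr) (hN : Measurable N) (hγ : Measurable γ)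
    (hP : IsTransitionFamily X P) (hδ : δ < 1)
    (hD : ∀ᵐ ω ∂Pr, ∀ k : ℤ, DoeblinAt X P N γ m (shift k ω))
    {w : ℕ → ℝ} (hw : ∀ n, 0 < w n) {k r : ℕ → ℕ}
    (hkr : ∀ n, k n * (3 * r n) ≤ n) (hr : Tendsto r atTop atTop) {S : Set ℝ}
    (hS : S.Nonempty) (hS0 : ∀ d ∈ S, 0 < d)
    (hsum : ∀ d ∈ S, ∀ ρ : ℝ, 0 < ρ → ρ < 1 →
      Summable fun n => w n ^ d * (ρ ^ k n + k n * (r n * b (r n)))) :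
    ∃ K : (ℤ → 𝒴) → ℝ, (∀ d ∈ S, MemLp K (ENNReal.ofReal d) Pr) ∧
      ∀ᵐ ω ∂Pr, ∀ n : ℕ,
        OscLE (iter P (shift (-(n : ℤ)) ω) n) (X (shift (-(n : ℤ)) ω)) (K ω * (w n)⁻¹) := by
  have hKm := measurable_rateConst hN hγ δ M w k r
  have hlt := fun d (hd : d ∈ S) =>
    hA.lintegral_rateConst_lt_top hstat hN hγ hδ (fun n => (hw n).le) hr (hS0 d hd) (hsum d hd)
  refine ⟨fun ω => (rateConst N γ δ M w k r ω).toReal, fun d hd => ?_, ?_⟩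
  · have hd0 := hS0 d hd
    refine ⟨hKm.ennreal_toReal.aestronglyMeasurable, ?_⟩
    rw [eLpNorm_lt_top_iff_lintegral_rpow_enorm_lt_top (by simpa using hd0) (by simp),
      ENNReal.toReal_ofReal hd0.le]
    refine (lintegral_mono fun ω => ?_).trans_lt (hlt d hd)
    refine ENNReal.rpow_le_rpow ?_ hd0.le
    rw [Real.enorm_of_nonneg ENNReal.toReal_nonneg]
    exact ENNReal.ofReal_toReal_le
  · obtain ⟨d, hd⟩ := hS
    have hfin := ae_lt_top (hKm.pow_const d) (hlt d hd).ne
    filter_upwards [hfin, hD] with ω hω hDω n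
    -- One exponent in `S` suffices for almost sure finiteness. Without it `toReal` could replace
    -- `∞` by `0` and the bound would fail.
    have hne : rateConst N γ δ M w k r ω ≠ ∞ := fun h => by
      simp [h, ENNReal.top_rpow_of_pos (hS0 d hd)] at hω
    -- If `3 * r n < M`, blocks may be too short for the minorization; the factor is then `1` and
    -- the bound trivial. Thus every `n` is covered, not only large ones.
    have hosc : OscLE (iter P (shift (-(n : ℤ)) ω) n) (X (shift (-(n : ℤ)) ω))
        (decayFactor N γ δ M (k n) (r n) ω) := by
      unfold decayFactor
      split
      next h => exact oscLE_iter_of_hits hP hDω h (hkr n)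
      next => exact (hP.mapsProb_iter_neg_self ω n).oscLE_one
    refine hosc.mono ?_
    rw [← div_eq_mul_inv, le_div_iff₀ (hw n), mul_comm,
      ← ENNReal.toReal_ofReal (mul_nonneg (hw n).le (decayFactor_nonneg hδ (k n) (r n) ω))]
    exact ENNReal.toReal_mono hne
      (le_iSup (fun n => ENNReal.ofReal (w n * decayFactor N γ δ M (k n) (r n) ω)) n)

end

/-! ### Choice of sampling parameters and summability. -/

section Asymptotics

theorem exp_neg_mul_rpow_isLittleO {c s : ℝ} (hc : 0 < c) (hs : 0 < s) (p : ℝ) :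
    (fun n : ℕ => Real.exp (-c * (n : ℝ) ^ s)) =o[atTop] fun n : ℕ => (n : ℝ) ^ p := by
  have h := (isLittleO_exp_neg_mul_rpow_atTop hc (p / s)).comp_tendsto
    ((tendsto_rpow_atTop hs).comp tendsto_natCast_atTop_atTop)
  refine h.congr_right fun n => ?_
  simp only [Function.comp]
  rw [← Real.rpow_mul (Nat.cast_nonneg n), mul_div_cancel₀ _ hs.ne']

theorem summable_rpow_mul_exp_neg {c s : ℝ} (hc : 0 < c) (hs : 0 < s) (p : ℝ) :
    Summable fun n : ℕ => (n : ℝ) ^ p * Real.exp (-c * (n : ℝ) ^ s) := by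
  refine summable_of_isBigO_nat (Real.summable_nat_rpow.2 (show (-2 : ℝ) < -1 by norm_num)) ?_
  refine (((isBigO_refl (fun n : ℕ => (n : ℝ) ^ p) atTop).mul
    (exp_neg_mul_rpow_isLittleO hc hs (-2 - p)).isBigO)).congr' EventuallyEq.rfl ?_
  filter_upwards [eventually_gt_atTop 0] with n hn
  rw [← Real.rpow_add (by exact_mod_cast hn)]
  congr 1
  ring

theorem StretchedExpDecay.polyDecay {b : ℕ → ℝ} {a η : ℝ} (ha : 0 < a) (hη : 0 < η)
    (h : StretchedExpDecay b a η) (p : ℝ) : PolyDecay b p :=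
  h.trans (exp_neg_mul_rpow_isLittleO ha hη (-p)).isBigO

/-- The number `⌊n ^ s⌋` of samples taken from a backward orbit of length `n`. -/
noncomputable def sampleCount (s : ℝ) (n : ℕ) : ℕ := ⌊(n : ℝ) ^ s⌋₊

/-- One third of the spacing between `sampleCount s n` samples taken from a backward orbit of
length `n`. -/
noncomputable def sampleGap (s : ℝ) (n : ℕ) : ℕ := n / (3 * sampleCount s n)

theorem sampleCount_mul_sampleGap_le (s : ℝ) (n : ℕ) :
    sampleCount s n * (3 * sampleGap s n) ≤ n := by
  calc sampleCount s n * (3 * sampleGap s n) = 3 * sampleCount s n * sampleGap s n := by ring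
    _ ≤ n := Nat.mul_div_le n _

theorem sampleCount_le (s : ℝ) (n : ℕ) : (sampleCount s n : ℝ) ≤ (n : ℝ) ^ s :=
  Nat.floor_le (by positivity)

theorem eventually_le_sampleCount {s : ℝ} (hs : 0 < s) :
    ∀ᶠ n : ℕ in atTop, (n : ℝ) ^ s / 2 ≤ sampleCount s n := by
  filter_upwards [((tendsto_rpow_atTop hs).comp tendsto_natCast_atTop_atTop).eventually_ge_atTop 2]
    with n hn
  have h := Nat.lt_floor_add_one ((n : ℝ) ^ s)
  simp only [Function.comp] at hn
  rw [sampleCount]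
  linarith

theorem eventually_le_sampleGap {s : ℝ} (hs : 0 < s) (hs1 : s < 1) :
    ∀ᶠ n : ℕ in atTop, (n : ℝ) ^ (1 - s) / 4 ≤ sampleGap s n := by
  -- Rounding gives `n ^ (1 - s) < 3 * (sampleGap s n + 1)`; the threshold `12` absorbs the additive
  -- `3` when `1 / 3` is weakened to `1 / 4`.
  filter_upwards [((tendsto_rpow_atTop (sub_pos.2 hs1)).comp
    tendsto_natCast_atTop_atTop).eventually_ge_atTop 12, eventually_le_sampleCount hs,
    eventually_gt_atTop 0] with n hn hk hn0
  simp only [Function.comp] at hn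
  have hn0' : (0 : ℝ) < n := by exact_mod_cast hn0
  have hns : 0 < (n : ℝ) ^ s := Real.rpow_pos_of_pos hn0' _
  have hk0 : 0 < 3 * sampleCount s n := by
    have : (0 : ℝ) < sampleCount s n := by linarith
    have : 0 < sampleCount s n := by exact_mod_cast this
    omega
  have h1 : (n : ℝ) < 3 * sampleCount s n * (sampleGap s n + 1) := by
    exact_mod_cast Nat.lt_mul_div_succ n hk0
  have h2 : (n : ℝ) < 3 * (n : ℝ) ^ s * (sampleGap s n + 1) := by
    refine h1.trans_le ?_
    gcongr
    exact sampleCount_le s n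
  have h3 : (n : ℝ) = (n : ℝ) ^ s * (n : ℝ) ^ (1 - s) := by
    rw [← Real.rpow_add hn0']
    simp
  have h4 : (n : ℝ) ^ (1 - s) < 3 * (sampleGap s n + 1) := by
    refine lt_of_mul_lt_mul_left ?_ hns.le
    rw [← h3]
    linarith
  linarith

theorem tendsto_sampleGap {s : ℝ} (hs : 0 < s) (hs1 : s < 1) :
    Tendsto (sampleGap s) atTop atTop := by
  rw [← tendsto_natCast_atTop_iff (R := ℝ)]
  exact tendsto_atTop_mono' atTop (eventually_le_sampleGap hs hs1)
    (((tendsto_rpow_atTop (sub_pos.2 hs1)).comp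
      tendsto_natCast_atTop_atTop).atTop_div_const (by norm_num))

theorem eventually_pow_sampleCount_le {s ρ : ℝ} (hs : 0 < s) (hρ0 : 0 < ρ) (hρ1 : ρ < 1) :
    ∀ᶠ n : ℕ in atTop,
      ρ ^ sampleCount s n ≤ Real.exp (-(-Real.log ρ / 2) * (n : ℝ) ^ s) := by
  filter_upwards [eventually_le_sampleCount hs] with n hn
  rw [← Real.rpow_natCast, Real.rpow_def_of_pos hρ0, Real.exp_le_exp]
  have := mul_le_mul_of_nonpos_left hn (Real.log_neg hρ0 hρ1).le
  linarith

/-- The term `ρ ^ (n ^ s)` beats every power. The other one is of order at most `n ^ p * n ^ s * (n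
^ (1 - s)) ^ (1 - a)`, whose exponent is the one in `hp`. -/
theorem summable_of_polyDecay {b : ℕ → ℝ} {a p s ρ : ℝ} (hb0 : ∀ r, 0 ≤ b r) (hb : PolyDecay b a)
    (ha : 1 ≤ a) (hs : 0 < s) (hs1 : s < 1) (hp : p + s + (1 - s) * (1 - a) < -1)
    (hρ0 : 0 < ρ) (hρ1 : ρ < 1) :
    Summable fun n : ℕ => (n : ℝ) ^ p *
      (ρ ^ sampleCount s n + sampleCount s n * (sampleGap s n * b (sampleGap s n))) := by
  obtain ⟨C, hC⟩ := hb.bound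
  have hc : 0 < -Real.log ρ / 2 := by linarith [Real.log_neg hρ0 hρ1]
  have hsum := (summable_rpow_mul_exp_neg hc hs p).add
    ((Real.summable_nat_rpow.2 hp).mul_left (|C| * (1 / 4) ^ (1 - a)))
  refine Summable.of_norm_bounded_eventually_nat hsum ?_
  filter_upwards [eventually_pow_sampleCount_le hs hρ0 hρ1,
    (tendsto_sampleGap hs hs1).eventually hC, eventually_le_sampleGap hs hs1,
    eventually_gt_atTop 0] with n h1 h2 h3 hn
  have hn0 : (0 : ℝ) < n := by exact_mod_cast hn
  have hbn := hb0 (sampleGap s n)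
  rw [Real.norm_of_nonneg (by positivity), mul_add]
  have hr0 : 0 < (sampleGap s n : ℝ) := lt_of_lt_of_le (by positivity) h3
  rw [Real.norm_of_nonneg hbn, Real.norm_of_nonneg (by positivity)] at h2
  refine add_le_add (by gcongr) ?_
  have h4 : (sampleGap s n : ℝ) * b (sampleGap s n) ≤
      |C| * ((1 / 4) ^ (1 - a) * (n : ℝ) ^ ((1 - s) * (1 - a))) := by
    calc (sampleGap s n : ℝ) * b (sampleGap s n)
        ≤ sampleGap s n * (|C| * (sampleGap s n : ℝ) ^ (-a)) := by
          gcongr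
          exact h2.trans (mul_le_mul_of_nonneg_right (le_abs_self C) (by positivity))
      _ = |C| * (sampleGap s n : ℝ) ^ (1 - a) := by
          rw [sub_eq_add_neg, Real.rpow_add hr0, Real.rpow_one]
          ring
      _ ≤ |C| * ((1 / 4 : ℝ) * (n : ℝ) ^ (1 - s)) ^ (1 - a) := by
          refine mul_le_mul_of_nonneg_left ?_ (abs_nonneg _)
          refine Real.rpow_le_rpow_of_nonpos (by positivity) ?_ (by linarith)
          linarith
      _ = _ := by
          rw [Real.mul_rpow (by norm_num) (by positivity), ← Real.rpow_mul hn0.le]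
  calc (n : ℝ) ^ p * (sampleCount s n * (sampleGap s n * b (sampleGap s n)))
      ≤ (n : ℝ) ^ p * ((n : ℝ) ^ s *
          (|C| * ((1 / 4) ^ (1 - a) * (n : ℝ) ^ ((1 - s) * (1 - a))))) := by
        gcongr
        exact sampleCount_le s n
    _ = |C| * (1 / 4) ^ (1 - a) * (n : ℝ) ^ (p + s + (1 - s) * (1 - a)) := by
        rw [Real.rpow_add hn0, Real.rpow_add hn0]
        ring

/-- The exponent `s = η / (1 + η)` solves `(1 - s) * η = s`, so `ρ ^ k` and `b r` are both at most
of order `exp(-c n ^ s)`. As `κ < s`, half of `c` absorbs the weight. -/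
theorem summable_of_stretchedExpDecay {b : ℕ → ℝ} {a η κ d ρ : ℝ} (hb0 : ∀ r, 0 ≤ b r)
    (ha : 0 < a) (hη : 0 < η) (hb : StretchedExpDecay b a η) (hκ : κ < η / (1 + η))
    (hρ0 : 0 < ρ) (hρ1 : ρ < 1) :
    Summable fun n : ℕ => Real.exp ((n : ℝ) ^ κ) ^ d *
      (ρ ^ sampleCount (η / (1 + η)) n + sampleCount (η / (1 + η)) n *
        (sampleGap (η / (1 + η)) n * b (sampleGap (η / (1 + η)) n))) := by
  set s := η / (1 + η) with hs_def
  have hs : 0 < s := by positivity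
  have hs1 : s < 1 := by rw [hs_def, div_lt_one (by positivity)]; linarith
  have hsη : (1 - s) * η = s := by rw [hs_def]; field_simp; ring
  obtain ⟨C, hC⟩ := hb.bound
  set c := min (-Real.log ρ / 2) (a * (1 / 4) ^ η) with hc_def
  have hc : 0 < c := lt_min (by linarith [Real.log_neg hρ0 hρ1]) (by positivity)
  have hsum := (summable_rpow_mul_exp_neg (half_pos hc) hs 1).mul_left (1 + |C|)
  have hκs : ∀ᶠ n : ℕ in atTop, d * (n : ℝ) ^ κ ≤ c / 2 * (n : ℝ) ^ s := by
    have h := (((tendsto_rpow_neg_atTop (sub_pos.2 hκ)).comp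
      tendsto_natCast_atTop_atTop).const_mul d).eventually (gt_mem_nhds
        (show d * 0 < c / 2 by linarith))
    filter_upwards [h, eventually_gt_atTop 0] with n hn hn0
    have hn0' : (0 : ℝ) < n := by exact_mod_cast hn0
    have hX : 0 ≤ (n : ℝ) ^ s := by positivity
    calc d * (n : ℝ) ^ κ = d * (n : ℝ) ^ (-(s - κ)) * (n : ℝ) ^ s := by
          rw [mul_assoc, ← Real.rpow_add hn0']
          congr 2
          ring
      _ ≤ _ := mul_le_mul_of_nonneg_right hn.le hX
  refine Summable.of_norm_bounded_eventually_nat hsum ?_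
  filter_upwards [eventually_pow_sampleCount_le hs hρ0 hρ1,
    (tendsto_sampleGap hs hs1).eventually hC, eventually_le_sampleGap hs hs1, hκs,
    eventually_gt_atTop 0] with n h1 h2 h3 h4 hn
  have hn0 : (0 : ℝ) < n := by exact_mod_cast hn
  have hn1 : (1 : ℝ) ≤ n := by exact_mod_cast hn
  have hbn := hb0 (sampleGap s n)
  rw [Real.norm_of_nonneg (by positivity)]
  rw [Real.norm_of_nonneg hbn, Real.norm_of_nonneg (by positivity)] at h2
  have hX : 0 ≤ (n : ℝ) ^ s := by positivity
  have e1 : ρ ^ sampleCount s n ≤ n * Real.exp (-c * (n : ℝ) ^ s) := by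
    refine (h1.trans ?_).trans (le_mul_of_one_le_left (Real.exp_pos _).le hn1)
    rw [Real.exp_le_exp]
    exact mul_le_mul_of_nonneg_right (neg_le_neg (min_le_left _ _)) hX
  have e2 : b (sampleGap s n) ≤ |C| * Real.exp (-c * (n : ℝ) ^ s) := by
    refine h2.trans (mul_le_mul (le_abs_self C) ?_ (Real.exp_pos _).le (abs_nonneg _))
    rw [Real.exp_le_exp]
    have h5 : (1 / 4 : ℝ) ^ η * (n : ℝ) ^ s ≤ (sampleGap s n : ℝ) ^ η := by
      calc (1 / 4 : ℝ) ^ η * (n : ℝ) ^ s = ((1 / 4 : ℝ) * (n : ℝ) ^ (1 - s)) ^ η := by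
            rw [Real.mul_rpow (by norm_num) (by positivity), ← Real.rpow_mul hn0.le, hsη]
        _ ≤ _ := Real.rpow_le_rpow (by positivity) (by linarith) hη.le
    have h6 : c * (n : ℝ) ^ s ≤ a * (1 / 4) ^ η * (n : ℝ) ^ s :=
      mul_le_mul_of_nonneg_right (min_le_right _ _) hX
    have h7 := mul_le_mul_of_nonneg_left h5 ha.le
    linarith
  have e3 : (sampleCount s n : ℝ) * sampleGap s n ≤ n := by
    have h5 := sampleCount_mul_sampleGap_le s n
    have h6 : sampleCount s n * sampleGap s n ≤ sampleCount s n * (3 * sampleGap s n) :=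
      Nat.mul_le_mul_left _ (by omega)
    exact_mod_cast h6.trans h5
  have e4 : (sampleCount s n : ℝ) * (sampleGap s n * b (sampleGap s n)) ≤
      n * (|C| * Real.exp (-c * (n : ℝ) ^ s)) := by
    rw [← mul_assoc]
    exact mul_le_mul e3 e2 hbn hn0.le
  calc Real.exp ((n : ℝ) ^ κ) ^ d *
        (ρ ^ sampleCount s n + sampleCount s n * (sampleGap s n * b (sampleGap s n)))
      ≤ Real.exp (c / 2 * (n : ℝ) ^ s) * (n * Real.exp (-c * (n : ℝ) ^ s) +
          n * (|C| * Real.exp (-c * (n : ℝ) ^ s))) := by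
        refine mul_le_mul ?_ (add_le_add e1 e4) (by positivity) (Real.exp_pos _).le
        rw [← Real.exp_mul, Real.exp_le_exp]
        linarith
    _ = (1 + |C|) * ((n : ℝ) ^ (1 : ℝ) *
          (Real.exp (c / 2 * (n : ℝ) ^ s) * Real.exp (-c * (n : ℝ) ^ s))) := by
        rw [Real.rpow_one]; ring
    _ = (1 + |C|) * ((n : ℝ) ^ (1 : ℝ) * Real.exp (-(c / 2) * (n : ℝ) ^ s)) := by
        rw [← Real.exp_add]
        congr 4
        ring

end Asymptotics

/-! ### Contraction rates in the two decay regimes; invariant sets of environments. -/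

section

variable {𝒴 : Type*} [MeasurableSpace 𝒴] {Pr : Measure (ℤ → 𝒴)} [IsProbabilityMeasure Pr]
  {N : (ℤ → 𝒴) → ℕ} {γ : (ℤ → 𝒴) → ℝ} {δ : ℝ} {M : ℕ} {A B : ℕ → Set (ℤ → 𝒴)} {b : ℕ → ℝ}
  {p₀ : ℝ} {𝒳 : Type*} [MeasurableSpace 𝒳] {X : (ℤ → 𝒴) → Set 𝒳}
  {P : Kernel ((ℤ → 𝒴) × 𝒳) 𝒳} {m : (ℤ → 𝒴) → Measure 𝒳}

theorem EnvAssumption.exists_rate_of_polyDecay (hA : EnvAssumption Pr N γ δ M A B b p₀)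
    (hstat : MeasurePreserving (shift 1) Pr Pr) (hN : Measurable N) (hγ : Measurable γ)
    (hP : IsTransitionFamily X P) (hδ : δ < 1)
    (hD : ∀ᵐ ω ∂Pr, ∀ k : ℤ, DoeblinAt X P N γ m (shift k ω))
    {a β d : ℝ} (ha : 3 < a) (hb : PolyDecay b a) (hd : 0 < d) (hβ : 3 + β * d < a) :
    ∃ K : (ℤ → 𝒴) → ℝ, MemLp K (ENNReal.ofReal d) Pr ∧
      ∀ᵐ ω ∂Pr, ∀ n : ℕ, 1 ≤ n →
        OscLE (iter P (shift (-(n : ℤ)) ω) n) (X (shift (-(n : ℤ)) ω))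
          (K ω * (n : ℝ) ^ (-β)) := by
  -- Weights must be positive, while `0 ^ β = 0` for `β ≠ 0`.
  set w : ℕ → ℝ := fun n => if n = 0 then 1 else (n : ℝ) ^ β with hw
  have hw0 : ∀ n, 0 < w n := fun n => by
    simp only [hw]
    split
    · exact one_pos
    · have : (0 : ℝ) < n := by exact_mod_cast Nat.pos_of_ne_zero ‹_›
      positivity
  have hs : 0 < 1 / a := by positivity
  have hs1 : 1 / a < 1 := by rw [div_lt_one (by linarith)]; linarith
  -- For `s = 1 / a` the left side equals `β * d + 2 - a`, so the inequality is exactly `3 + β * d <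
  -- a`.
  have hexp : β * d + 1 / a + (1 - 1 / a) * (1 - a) < -1 := by
    have : 1 / a * a = 1 := by field_simp
    nlinarith
  obtain ⟨K, hK, hosc⟩ := hA.exists_rate hstat hN hγ hP hδ hD hw0
    (sampleCount_mul_sampleGap_le (1 / a)) (tendsto_sampleGap hs hs1) (S := {d})
    (Set.singleton_nonempty d) (by simpa using hd) (by
      rintro _ rfl ρ hρ0 hρ1
      refine (summable_of_polyDecay hA.b_nonneg hb (by linarith) hs hs1 hexp hρ0
        hρ1).of_norm_bounded_eventually_nat ?_
      filter_upwards [eventually_gt_atTop 0] with n hn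
      have hbn := hA.b_nonneg (sampleGap (1 / a) n)
      have hn0 : (0 : ℝ) < n := by exact_mod_cast hn
      simp only [hw, if_neg hn.ne']
      rw [← Real.rpow_mul hn0.le, Real.norm_of_nonneg (by positivity)])
  refine ⟨K, hK d rfl, hosc.mono fun ω hω n hn => ?_⟩
  have h := hω n
  simp only [hw, if_neg (show n ≠ 0 by omega)] at h
  rwa [Real.rpow_neg (Nat.cast_nonneg n)]

theorem EnvAssumption.exists_rate_of_stretchedExpDecay (hA : EnvAssumption Pr N γ δ M A B b p₀)
    (hstat : MeasurePreserving (shift 1) Pr Pr) (hN : Measurable N) (hγ : Measurable γ)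
    (hP : IsTransitionFamily X P) (hδ : δ < 1)
    (hD : ∀ᵐ ω ∂Pr, ∀ k : ℤ, DoeblinAt X P N γ m (shift k ω))
    {a η κ : ℝ} (ha : 0 < a) (hη : 0 < η) (hb : StretchedExpDecay b a η)
    (hκ : κ < η / (1 + η)) :
    ∃ K : (ℤ → 𝒴) → ℝ, (∀ q : ℝ≥0, 1 ≤ q → MemLp K q Pr) ∧
      ∀ᵐ ω ∂Pr, ∀ n : ℕ,
        OscLE (iter P (shift (-(n : ℤ)) ω) n) (X (shift (-(n : ℤ)) ω))
          (K ω * Real.exp (-(n : ℝ) ^ κ)) := by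
  have hs : 0 < η / (1 + η) := by positivity
  have hs1 : η / (1 + η) < 1 := by rw [div_lt_one (by positivity)]; linarith
  obtain ⟨K, hK, hosc⟩ := hA.exists_rate hstat hN hγ hP hδ hD
    (w := fun n => Real.exp ((n : ℝ) ^ κ)) (fun n => Real.exp_pos _)
    (sampleCount_mul_sampleGap_le (η / (1 + η))) (tendsto_sampleGap hs hs1) (S := Set.Ici 1)
    Set.nonempty_Ici (fun d hd => lt_of_lt_of_le one_pos hd)
    (fun d _ ρ hρ0 hρ1 => summable_of_stretchedExpDecay hA.b_nonneg ha hη hb hκ hρ0 hρ1)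
  refine ⟨K, fun q hq => ?_, hosc.mono fun ω hω n => ?_⟩
  · simpa using hK q (by exact_mod_cast hq)
  · rw [Real.exp_neg]
    exact hω n

/-- Stretched exponential decay beats every power, so the polynomial regime alone suffices to
construct `μ`. -/
theorem EnvAssumption.exists_polyDecay {Pr : Measure (ℤ → 𝒴)}
    (hA : EnvAssumption Pr N γ δ M A B b p₀) :
    ∃ a : ℝ, 3 < a ∧ PolyDecay b a := by
  rcases hA.decay with h | ⟨a, η, ha, hη, h⟩
  · exact h
  · exact ⟨4, by norm_num, h.polyDecay ha hη 4⟩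

theorem EnvAssumption.ae_exists_oscLE (hA : EnvAssumption Pr N γ δ M A B b p₀)
    (hstat : MeasurePreserving (shift 1) Pr Pr) (hN : Measurable N) (hγ : Measurable γ)
    (hP : IsTransitionFamily X P) (hδ : δ < 1)
    (hD : ∀ᵐ ω ∂Pr, ∀ k : ℤ, DoeblinAt X P N γ m (shift k ω)) :
    ∀ᵐ ω ∂Pr, ∀ ε > 0, ∃ n : ℕ,
      OscLE (iter P (shift (-(n : ℤ)) ω) n) (X (shift (-(n : ℤ)) ω)) ε := by
  obtain ⟨a, ha, hb⟩ := hA.exists_polyDecay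
  -- Any `β` strictly between `0` and `a - 3` would do: `β > 0` forces decay, and `3 + β < a` is
  -- admissible with `d = 1`.
  obtain ⟨K, -, hK⟩ := hA.exists_rate_of_polyDecay hstat hN hγ hP hδ hD (d := 1)
    (β := (a - 3) / 2) ha hb one_pos (by linarith)
  filter_upwards [hK] with ω hω ε hε
  have hlim : Tendsto (fun n : ℕ => K ω * (n : ℝ) ^ (-((a - 3) / 2))) atTop (𝓝 (K ω * 0)) :=
    ((tendsto_rpow_neg_atTop (by linarith)).comp tendsto_natCast_atTop_atTop).const_mul _
  rw [mul_zero] at hlim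
  obtain ⟨n, hn, hn1⟩ := ((hlim.eventually (gt_mem_nhds hε)).and (eventually_ge_atTop 1)).exists
  exact ⟨n, (hω n hn1).mono hn.le⟩

/-- An almost sure property holds on all orbits starting in an invariant measurable set of full
measure. -/
theorem exists_invariant_measurableSet {Pr : Measure (ℤ → 𝒴)}
    (hstat : MeasurePreserving (shift 1) Pr Pr)
    {p : (ℤ → 𝒴) → Prop} (hp : ∀ᵐ ω ∂Pr, p ω) :
    ∃ Ω₀ : Set (ℤ → 𝒴), MeasurableSet Ω₀ ∧ (∀ᵐ ω ∂Pr, ω ∈ Ω₀) ∧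
      (∀ k : ℤ, ∀ ω ∈ Ω₀, shift k ω ∈ Ω₀) ∧ ∀ ω ∈ Ω₀, p ω := by
  obtain ⟨G, hG, hGm, hGp⟩ := hp.exists_measurable_mem
  refine ⟨⋂ k : ℤ, shift k ⁻¹' G, MeasurableSet.iInter fun k => measurable_shift k hGm, ?_, ?_, ?_⟩
  · simp only [Set.mem_iInter]
    exact ae_all_iff.2 fun k => (measurePreserving_shift hstat k).quasiMeasurePreserving.ae hG
  · intro k ω hω
    simp only [Set.mem_iInter, Set.mem_preimage, shift_shift] at hω ⊢
    exact fun j => hω (j + k)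
  · intro ω hω
    have h := Set.mem_iInter.1 hω 0
    rw [Set.mem_preimage, shift_zero] at h
    exact hGp ω h

end

end RandomEnv

theorem lemma2p2 {𝒴 : Type*} [MeasurableSpace 𝒴] {𝒳 : Type*} [MeasurableSpace 𝒳]
    (Pr : Measure (ℤ → 𝒴)) [IsProbabilityMeasure Pr]
    (hstat : MeasurePreserving (shift 1) Pr Pr) (hmix : IsMixing Pr)
    (X : (ℤ → 𝒴) → Set 𝒳) (P : Kernel ((ℤ → 𝒴) × 𝒳) 𝒳) (hP : IsTransitionFamily X P)
    (N : (ℤ → 𝒴) → ℕ) (hN : Measurable N) (γ : (ℤ → 𝒴) → ℝ) (hγ : Measurable γ)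
    (m : (ℤ → 𝒴) → Measure 𝒳) (hD : Doeblin Pr X P N γ m)
    (δ : ℝ) (M : ℕ) (A B : ℕ → Set (ℤ → 𝒴)) (b : ℕ → ℝ) (p₀ : ℝ)
    (hA : EnvAssumption Pr N γ δ M A B b p₀) :
    ∃ μ : (ℤ → 𝒴) → Measure 𝒳,
      (∀ᵐ ω ∂Pr, IsProbabilityMeasure (μ ω) ∧ μ ω (X ω)ᶜ = 0) ∧
      (∀ᵐ ω ∂Pr, μ (shift 1 ω) = (P.sectR ω) ∘ₘ (μ ω)) ∧
      (Measurable m → Measurable μ) ∧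
      (∀ a : ℝ, 3 < a → PolyDecay b a →
        ∀ β d : ℝ, 0 < d → 3 + β * d < a →
          ∃ K : (ℤ → 𝒴) → ℝ, MemLp K (ENNReal.ofReal d) Pr ∧
            ∀ᵐ ω ∂Pr, ∀ n : ℕ, 1 ≤ n → ∀ x ∈ X (shift (-(n : ℤ)) ω),
              ∀ Γ ⊆ X ω, MeasurableSet Γ →
                |(iter P (shift (-(n : ℤ)) ω) n x).real Γ - (μ ω).real Γ|
                  ≤ K ω * (n : ℝ) ^ (-β)) ∧
      (∀ a η : ℝ, 0 < a → 0 < η → StretchedExpDecay b a η →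
        ∀ κ : ℝ, κ < η / (1 + η) →
          ∃ K : (ℤ → 𝒴) → ℝ, (∀ q : ℝ≥0, 1 ≤ q → MemLp K q Pr) ∧
            ∀ᵐ ω ∂Pr, ∀ n : ℕ, 1 ≤ n → ∀ x ∈ X (shift (-(n : ℤ)) ω),
              ∀ Γ ⊆ X ω, MeasurableSet Γ →
                |(iter P (shift (-(n : ℤ)) ω) n x).real Γ - (μ ω).real Γ|
                  ≤ K ω * Real.exp (-(n : ℝ) ^ κ)) := by
  have hDall : ∀ᵐ ω ∂Pr, ∀ k : ℤ, DoeblinAt X P N γ m (shift k ω) :=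
    ae_all_iff.2 fun k => (measurePreserving_shift hstat k).quasiMeasurePreserving.ae hD
  have hδ : δ < 1 := hA.delta_lt_one (hD.mono fun ω hω => hω.1.2)
  -- Pullbacks visit the whole backward orbit and equivariance links `ω` to `θ ω`, so the good
  -- environments must form an invariant set.
  obtain ⟨Ω₀, hΩm, hΩ, hinv, hgood⟩ := exists_invariant_measurableSet hstat
    (hDall.and (hA.ae_exists_oscLE hstat hN hγ hP hδ hDall))
  -- `μ` is fixed before any rate is chosen; `hrate` converts each later bound on the coefficients
  -- into a distance to this same `μ`.
  obtain ⟨μ, hμ, hequi, hmeas, hrate⟩ := exists_equivariant_family hP hΩm hinv (m := m)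
    (fun ω hω => by
      have h := (hgood ω hω).1 0
      rw [shift_zero] at h
      exact ⟨h.2.1, h.2.2.1⟩)
    (fun ω hω => (hgood ω hω).2)
  refine ⟨μ, hΩ.mono hμ, hΩ.mono hequi, hmeas, fun a ha hb β d hd hβ => ?_,
    fun a η ha hη hb κ hκ => ?_⟩
  · obtain ⟨K, hK, hosc⟩ := hA.exists_rate_of_polyDecay hstat hN hγ hP hδ hDall ha hb hd hβ
    refine ⟨K, hK, ?_⟩
    filter_upwards [hΩ, hosc] with ω hω hω' n hn x hx Γ _ hΓm
    exact hrate ω hω n _ (hω' n hn) x hx Γ hΓm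
  · obtain ⟨K, hK, hosc⟩ :=
      hA.exists_rate_of_stretchedExpDecay hstat hN hγ hP hδ hDall ha hη hb hκ
    refine ⟨K, hK, ?_⟩
    filter_upwards [hΩ, hosc] with ω hω hω' n _ x hx Γ _ hΓm
    exact hrate ω hω n _ (hω' n) x hx Γ hΓm
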